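/- **Setting.** Let $t=(t_1,t_2,\dots)$ with $x=t_1$, and let $\theta_{m,n}=-\theta_{n,m}$ ($m,n\ge 1$) be deformation parameters. Functions $f(t,\theta)$ are formal power series in the $\theta_{m,n}$, $m<n$, with coefficients in a ring $\mathcal R$ of functions of $t$, i.e. a (not necessarily commutative) $\mathbb Q$-algebra with pairwise commuting derivations $\partial_{t_n}$, $n\ge1$; subscripts denote partial derivatives. They are multiplied with the Moyal product $$f\ast g=\mathbf m\circ e^{P/2}(f\otimes g),\qquad P=\sum_{m,n\ge1}\theta_{m,n}\,\partial_{t_m}\otimes\partial_{t_n},\qquad \mathbf m(f\otimes g)=fg .$$ Formal pseudo-differential operators $\sum_{j\le N}a_j\partial^j$ ($\partial=\partial/\partial x$) are multiplied by $(a\,\partial^i)\ast(b\,\partial^j)=\sum_{k\ge0}\binom ik\,a\ast(\partial_x^kb)\,\partial^{i+j-k}$; $(\cdot)_{\ge0}$ and $(\cdot)_{<0}$ are the parts with non-negative and negative powers of $\partial$; derivatives with respect to $t_n$ and $\theta_{m,n}$ act on coefficients; $[A,B]_\ast=A\ast B-B\ast A$. Let $X=1+\sum_{i\ge1}w_i\partial^{-i}$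 with inverse $X^{-1}$, and put $$L=X\ast\partial\ast X^{-1},\quad L^{(n)}=(L^n)_{\ge0},\quad \bar L^{(n)}=(L^n)_{<0},\quad W^{(m,n)}=\tfrac12\big(\bar L^{(n)}\ast L^{(m)}-\bar L^{(m)}\ast L^{(n)}\big)_{\ge0}.$$ Consider the equations ($m,n\ge1$) (1) $L_{t_n}=[L^{(n)},L]_\ast$ (the ncKP hierarchy), (2) $X_{t_n}=-(X\ast\partial^n\ast X^{-1})_{<0}\ast X$ (the ncKP hierarchy in terms of $X$), (3) $L_{\theta_{m,n}}=[W^{(m,n)},L]_\ast+\tfrac12\big(L_{t_n}\ast L^{(m)}-L_{t_m}\ast L^{(n)}\big)$, (4) $X_{\theta_{m,n}}=-\tfrac12\big(X_{t_m}\ast\partial^n\ast X^{-1}-X_{t_n}\ast\partial^m\ast X^{-1}\big)_{<0}\ast X$, (5) $X_{\theta_{m,n}}=\tfrac12\big(\bar L^{(m)}\ast L^n-\bar L^{(n)}\ast L^m\big)_{<0}\ast X$. **Theorem 3.1.** Let $S$ be any set of pairs $(m,n)$ with $m,n\ge1$ (for example one pair, or all pairs). (a) For every $\mathcal R$, suppose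 that $X$ satisfies (2) for all $n$. Then (4) and (5) are equivalent for each pair $(m,n)$, and they imply (3) for that pair. Moreover $L$ satisfies (3) for all $(m,n)\in S$ if and only if there is an operator $C=1+\sum_{i\ge1}c_i\partial^{-i}$ with coefficients independent of all the times $t_r$, such that $X\ast C$ satisfies (2) for all $n$ and (4) for all $(m,n)\in S$. The same holds with (5) in place of (4). (b) Let $\mathcal R$ be the ring of $N\times N$ matrices of formal power series in $t_1,t_2,\dots$ over a commutative $\mathbb Q$-algebra, or the ring of $N\times N$ matrices of smooth real or complex functions of $t_1,t_2,\dots$ (functions on the real sequences with finitely many nonzero entries that are smooth along every finite-dimensional subspace). Suppose only that $L$ satisfies (1) for all $n$. Then $L$ satisfies (3) for all $(m,n)\in S$ if and only if there is an operator $C=1+\sum_{i\ge1}c_i\partial^{-i}$ with coefficients independent of $x$, such that $X\ast C$ satisfies (2) for all $n$ and (4) for all $(m,n)\in S$. The same holds with (5) in place of (4). (For such $C$, $X\ast C$ is again a dressing operator of the same $L$: $L=(X\ast C)\ast\partial\ast(X\ast C)^{-1}$.) -/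

import Mathlib

namespace NcKP

noncomputable section

/-! ## Functions of the times `t₁ = x, t₂, t₃, …` -/

/-- A system of pairwise commuting derivations `D n = ∂/∂tₙ` (`n = 1, 2, …`) of a ring `R`,
the ring of ("matrices of") functions of the times; `R` need not be commutative. -/
structure Times (R : Type*) [Ring R] where
  D : ℕ+ → R →+ R
  leibniz : ∀ n f g, D n (f * g) = D n f * g + f * D n g
  comm : ∀ m n f, D m (D n f) = D n (D m f)

/-- Entrywise action of commuting derivations of a ring on the matrices over that ring. -/
def Times.matrix {R : Type*} [Ring R] (T : Times R) (N : ℕ) :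
    Times (Matrix (Fin N) (Fin N) R) where
  D n :=
    { toFun := fun M => M.map (T.D n)
      map_zero' := by ext; simp
      map_add' := fun A B => by ext; simp }
  leibniz n f g := by
    ext i j
    simp [Matrix.mul_apply, T.leibniz, Finset.sum_add_distrib]
  comm m n f := by
    ext i j
    simp [T.comm m n]

/-- Formal power series in the times `t₁, t₂, …`, with the formal partial derivatives. -/
def formalTimes (K : Type*) [CommRing K] : Times (MvPowerSeries ℕ+ K) where
  D n := (MvPowerSeries.pderiv K n).toLinearMap.toAddMonoidHom
  leibniz n f g := by
    refine ((MvPowerSeries.pderiv K n).leibniz f g).trans ?_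
    rw [add_comm, smul_eq_mul, smul_eq_mul, mul_comm g]
    rfl
  comm m n f := by
    change MvPowerSeries.pderiv K m (MvPowerSeries.pderiv K n f) =
      MvPowerSeries.pderiv K n (MvPowerSeries.pderiv K m f)
    ext e
    simp only [MvPowerSeries.coeff_pderiv]
    by_cases h : m = n
    · subst h; rfl
    · have h' : n ≠ m := fun hh => h hh.symm
      rw [add_right_comm e (Finsupp.single m 1)]
      simp only [Finsupp.add_apply, Finsupp.single_eq_of_ne h, Finsupp.single_eq_of_ne h',
        add_zero]
      ring

/-- The space of times `t = (t₁, t₂, …)`: real sequences with finitely many nonzero entries. -/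
abbrev TimeSpace := ℕ+ →₀ ℝ

/-- A function of the times is smooth if it is smooth (in the ordinary sense) along every
finite-dimensional space of times, i.e. as a function of any finite number of the times. -/
def IsSmooth {𝕜 : Type*} [RCLike 𝕜] (f : TimeSpace → 𝕜) : Prop :=
  ∀ (E : Type) [NormedAddCommGroup E] [NormedSpace ℝ E] [FiniteDimensional ℝ E]
    (A : E →ₗ[ℝ] TimeSpace), ContDiff ℝ (⊤ : ℕ∞) (fun v => f (A v))

/-- The algebra of smooth functions of the times. -/
def SmoothFn (𝕜 : Type*) [RCLike 𝕜] : Subalgebra ℚ (TimeSpace → 𝕜) where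
  carrier := {f | IsSmooth f}
  mul_mem' hf hg := fun E _ _ _ A => (hf E A).mul (hg E A)
  add_mem' hf hg := fun E _ _ _ A => (hf E A).add (hg E A)
  algebraMap_mem' _ := fun _ _ _ _ _ => contDiff_const

/-- The partial derivative `∂f/∂tₙ` of a function of the times. -/
def partialT {𝕜 : Type*} [RCLike 𝕜] (n : ℕ+) (f : TimeSpace → 𝕜) : TimeSpace → 𝕜 :=
  fun t => deriv (fun s : ℝ => f (t + s • Finsupp.single n 1)) 0

section Smooth

variable {𝕜 : Type*} [RCLike 𝕜]

theorem partialT_eq_fderiv {f : TimeSpace → 𝕜} (hf : IsSmooth f) {E : Type}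
    [NormedAddCommGroup E] [NormedSpace ℝ E] [FiniteDimensional ℝ E] (A : E →ₗ[ℝ] TimeSpace)
    (w : E) (n : ℕ+) (hw : A w = Finsupp.single n 1) (v : E) :
    partialT n f (A v) = fderiv ℝ (fun v => f (A v)) v w := by
  have h1 : HasFDerivAt (fun v => f (A v)) (fderiv ℝ (fun v => f (A v)) v) (v + (0 : ℝ) • w) := by
    rw [zero_smul, add_zero]
    exact ((hf E A).differentiable (by simp) v).hasFDerivAt
  have h2 : HasDerivAt (fun s : ℝ => v + s • w) w 0 := by
    simpa using ((hasDerivAt_id (0 : ℝ)).smul_const w).const_add v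
  have h3 := h1.comp_hasDerivAt (0 : ℝ) h2
  unfold partialT
  rw [← h3.deriv]
  congr 1
  funext s
  simp [Function.comp, hw]

theorem IsSmooth.partialT {f : TimeSpace → 𝕜} (hf : IsSmooth f) (n : ℕ+) :
    IsSmooth (partialT n f) := by
  intro E _ _ _ A
  let B : E × ℝ →ₗ[ℝ] TimeSpace :=
    A.coprod (LinearMap.toSpanSingleton ℝ TimeSpace (Finsupp.single n 1))
  have hB : B (0, 1) = Finsupp.single n 1 := by simp [B]
  have key : (fun v => NcKP.partialT n f (A v)) =
      fun v => fderiv ℝ (fun v => f (B v)) (v, 0) (0, 1) := by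
    funext v
    rw [← partialT_eq_fderiv hf B (0, 1) n hB (v, 0)]
    simp [B]
  rw [key]
  have h1 : ContDiff ℝ (⊤ : ℕ∞) (fderiv ℝ (fun v => f (B v))) :=
    (hf (E × ℝ) B).fderiv_right (by simp)
  exact (h1.comp (contDiff_id.prodMk contDiff_const)).clm_apply contDiff_const

/-- The linear map `(a, b, c) ↦ a t + b e_m + c e_n`. -/
def probe (t : TimeSpace) (m n : ℕ+) : ℝ × ℝ × ℝ →ₗ[ℝ] TimeSpace :=
  (LinearMap.toSpanSingleton ℝ TimeSpace t).coprod
    ((LinearMap.toSpanSingleton ℝ TimeSpace (Finsupp.single m 1)).coprod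
      (LinearMap.toSpanSingleton ℝ TimeSpace (Finsupp.single n 1)))

theorem partialT_add {f g : TimeSpace → 𝕜} (hf : IsSmooth f) (hg : IsSmooth g) (n : ℕ+) :
    partialT n (f + g) = partialT n f + partialT n g := by
  funext t
  have e1 : probe t n n (0, 1, 0) = Finsupp.single n 1 := by simp [probe]
  have e0 : probe t n n (1, 0, 0) = t := by simp [probe]
  have hd := fun (f : TimeSpace → 𝕜) (hf : IsSmooth f) =>
    partialT_eq_fderiv hf (probe t n n) (0, 1, 0) n e1 (1, 0, 0)
  rw [e0] at hd
  have hfg : IsSmooth (f + g) := (SmoothFn 𝕜).add_mem hf hg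
  rw [Pi.add_apply, hd f hf, hd g hg, hd _ hfg]
  have := fderiv_add (((hf _ (probe t n n)).differentiable (by simp)) (1, 0, 0))
    (((hg _ (probe t n n)).differentiable (by simp)) (1, 0, 0))
  exact congrArg (fun L => L (0, 1, 0)) this

theorem partialT_mul {f g : TimeSpace → 𝕜} (hf : IsSmooth f) (hg : IsSmooth g) (n : ℕ+) :
    partialT n (f * g) = partialT n f * g + f * partialT n g := by
  funext t
  have e1 : probe t n n (0, 1, 0) = Finsupp.single n 1 := by simp [probe]
  have e0 : probe t n n (1, 0, 0) = t := by simp [probe]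
  have hd := fun (f : TimeSpace → 𝕜) (hf : IsSmooth f) =>
    partialT_eq_fderiv hf (probe t n n) (0, 1, 0) n e1 (1, 0, 0)
  rw [e0] at hd
  have hfg : IsSmooth (f * g) := (SmoothFn 𝕜).mul_mem hf hg
  rw [Pi.add_apply, Pi.mul_apply, Pi.mul_apply, hd f hf, hd g hg, hd _ hfg]
  have := fderiv_mul (((hf _ (probe t n n)).differentiable (by simp)) (1, 0, 0))
    (((hg _ (probe t n n)).differentiable (by simp)) (1, 0, 0))
  refine (congrArg (fun L => L (0, 1, 0)) this).trans ?_
  simp only [add_apply, smul_apply, smul_eq_mul, e0]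
  ring

theorem partialT_comm {f : TimeSpace → 𝕜} (hf : IsSmooth f) (m n : ℕ+) :
    partialT m (partialT n f) = partialT n (partialT m f) := by
  funext t
  set A := probe t m n with hA
  have em : A (0, 1, 0) = Finsupp.single m 1 := by simp [hA, probe]
  have en : A (0, 0, 1) = Finsupp.single n 1 := by simp [hA, probe]
  have e0 : A (1, 0, 0) = t := by simp [hA, probe]
  set F := fun v => f (A v) with hF
  have hC : ContDiff ℝ (⊤ : ℕ∞) F := hf _ A
  have hdiff : DifferentiableAt ℝ (fderiv ℝ F) (1, 0, 0) :=
    ((hC.fderiv_right (m := (⊤ : ℕ∞)) (by simp)).differentiable (by simp)) _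
  have second : ∀ (k l : ℕ+) (u w : ℝ × ℝ × ℝ), A u = Finsupp.single k 1 →
      A w = Finsupp.single l 1 →
      partialT k (partialT l f) t = fderiv ℝ (fderiv ℝ F) (1, 0, 0) u w := by
    intro k l u w hu hw
    have h1 := partialT_eq_fderiv (hf.partialT l) A u k hu (1, 0, 0)
    rw [e0] at h1
    have h2 : (fun v => partialT l f (A v)) = fun v => fderiv ℝ F v w :=
      funext fun v => partialT_eq_fderiv hf A w l hw v
    rw [h1, h2, fderiv_clm_apply hdiff (differentiableAt_const _)]
    simp
  rw [second m n _ _ em en, second n m _ _ en em]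
  have hs : IsSymmSndFDerivAt ℝ F (1, 0, 0) :=
    (hC.contDiffAt).isSymmSndFDerivAt (by
      rw [minSmoothness_of_isRCLikeNormedField]; exact WithTop.coe_le_coe.mpr le_top)
  exact hs _ _

end Smooth

/-- Smooth functions of the times, with the partial derivatives. -/
def smoothTimes (𝕜 : Type*) [RCLike 𝕜] : Times (SmoothFn 𝕜) where
  D n :=
    { toFun := fun f => ⟨partialT n f.1, f.2.partialT n⟩
      map_zero' := by
        ext t
        simp [partialT]
      map_add' := fun f g => Subtype.ext (partialT_add f.2 g.2 n) }
  leibniz n f g := Subtype.ext (partialT_mul f.2 g.2 n)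
  comm m n f := Subtype.ext (partialT_comm f.2 m n)

/-! ## Functions of the times and the deformation parameters, and the Moyal product -/

/-- Labels `(m, n)`, `m < n`, of the independent deformation parameters `θ_{m,n}`. -/
abbrev Theta := {p : ℕ+ × ℕ+ // p.1 < p.2}

/-- Functions `f(t, θ)`: formal power series in the deformation parameters whose coefficients
are functions of the times. -/
abbrev Fn (R : Type*) := MvPowerSeries Theta R

section Functions

variable {R : Type*} [Ring R]

/-- `∂f/∂tₙ`. -/
def Fn.dt (T : Times R) (n : ℕ+) (f : Fn R) : Fn R := fun γ => T.D n (f γ)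

/-- `∂f/∂θ_{m,n}` for all `m, n`, where `θ_{n,m} = -θ_{m,n}`. -/
def Fn.dtheta (m n : ℕ+) (f : Fn R) : Fn R :=
  if h : m < n then MvPowerSeries.pderivFun ⟨(m, n), h⟩ f
  else if h : n < m then -MvPowerSeries.pderivFun ⟨(n, m), h⟩ f
  else 0

/-- `m ∘ Pᵏ (f ⊗ g)` for `P = ∑_{m,n} θ_{m,n} ∂_{t_m} ⊗ ∂_{t_n}`
`= ∑_{m<n} θ_{m,n} (∂_{t_m} ⊗ ∂_{t_n} - ∂_{t_n} ⊗ ∂_{t_m})`. The coefficient at `θ^γ` of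
`θ_{m,n} h` is that of `h` at `θ^γ / θ_{m,n}`, and is zero if `θ_{m,n}` does not divide `θ^γ`, so
that the infinite sum is finite in each degree. -/
def Fn.poisson (T : Times R) : ℕ → Fn R → Fn R → Fn R
  | 0, f, g => f * g
  | k + 1, f, g => fun γ => ∑ q ∈ γ.support,
      (Fn.poisson T k (f.dt T q.1.1) (g.dt T q.1.2) (γ - Finsupp.single q 1)
        - Fn.poisson T k (f.dt T q.1.2) (g.dt T q.1.1) (γ - Finsupp.single q 1))

/-- The Moyal product `f ∗ g = m ∘ exp(P/2) (f ⊗ g) = ∑ₖ 1/(2ᵏ k!) m ∘ Pᵏ (f ⊗ g)`. As `Pᵏ` has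
degree `k` in the deformation parameters, the terms with `k > |γ|` do not contribute to
the coefficient at `θ^γ`. -/
def Fn.star [Algebra ℚ R] (T : Times R) (f g : Fn R) : Fn R :=
  fun γ => ∑ k ∈ Finset.range (γ.degree + 1),
    ((1 : ℚ) / (2 ^ k * k.factorial)) • Fn.poisson T k f g γ

theorem Fn.poisson_eq_zero_of_degree_lt (T : Times R) (k : ℕ) (f g : Fn R) (γ : Theta →₀ ℕ)
    (h : γ.degree < k) : Fn.poisson T k f g γ = 0 := by
  induction k generalizing f g γ with
  | zero => omega
  | succ k ih =>
    refine Finset.sum_eq_zero fun q hq => ?_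
    have hle : Finsupp.single q 1 ≤ γ := by
      rw [Finsupp.single_le_iff]
      exact Nat.one_le_iff_ne_zero.mpr (Finsupp.mem_support_iff.mp hq)
    have hdeg : (γ - Finsupp.single q 1).degree < k := by
      have := congrArg Finsupp.degree (tsub_add_cancel_of_le hle)
      rw [map_add, Finsupp.degree_single] at this
      omega
    rw [ih _ _ _ hdeg, ih _ _ _ hdeg, sub_zero]

@[simp] theorem Fn.dt_zero (T : Times R) (n : ℕ+) : Fn.dt T n (0 : Fn R) = 0 := by
  funext γ
  exact map_zero (T.D n)

@[simp] theorem Fn.dtheta_zero (m n : ℕ+) : Fn.dtheta m n (0 : Fn R) = 0 := by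
  have h0 : ∀ i, MvPowerSeries.pderivFun i (0 : Fn R) = 0 := fun i => by
    ext e
    simp [MvPowerSeries.coeff_pderivFun]
  unfold Fn.dtheta
  split_ifs <;> simp [h0]

theorem Fn.poisson_zero_left (T : Times R) (k : ℕ) (g : Fn R) : Fn.poisson T k 0 g = 0 := by
  induction k generalizing g with
  | zero => simp [Fn.poisson]
  | succ k ih =>
    funext γ
    simp only [Fn.poisson, Fn.dt_zero, ih]
    exact Finset.sum_eq_zero fun q _ => sub_self (0 : R)

theorem Fn.poisson_zero_right (T : Times R) (k : ℕ) (f : Fn R) : Fn.poisson T k f 0 = 0 := by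
  induction k generalizing f with
  | zero => simp [Fn.poisson]
  | succ k ih =>
    funext γ
    simp only [Fn.poisson, Fn.dt_zero, ih]
    exact Finset.sum_eq_zero fun q _ => sub_self (0 : R)

@[simp] theorem Fn.zero_star [Algebra ℚ R] (T : Times R) (g : Fn R) : Fn.star T 0 g = 0 := by
  funext γ
  refine Finset.sum_eq_zero fun k _ => ?_
  rw [Fn.poisson_zero_left]
  exact smul_zero _

@[simp] theorem Fn.star_zero [Algebra ℚ R] (T : Times R) (f : Fn R) : Fn.star T f 0 = 0 := by
  funext γ
  refine Finset.sum_eq_zero fun k _ => ?_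
  rw [Fn.poisson_zero_right]
  exact smul_zero _

theorem Fn.dt_iterate_zero (T : Times R) (n : ℕ+) (k : ℕ) : (Fn.dt T n)^[k] (0 : Fn R) = 0 :=
  Function.iterate_fixed (Fn.dt_zero T n) k

end Functions

/-! ## Formal pseudo-differential operators -/

/-- Formal pseudo-differential operators `∑_{j ≤ N} a_j ∂^j`, where `∂ = ∂/∂x`, `x = t₁`. -/
@[ext] structure PDO {R : Type*} [Ring R] (T : Times R) where
  coeff : ℤ → Fn R
  bdd : ∃ N : ℤ, ∀ j, N < j → coeff j = 0

namespace PDO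

variable {R : Type*} [Ring R] {T : Times R}

instance : Zero (PDO T) := ⟨⟨0, 0, fun _ _ => rfl⟩⟩

/-- `∂^n` -/
def del (T : Times R) (n : ℕ) : PDO T :=
  ⟨fun j => if j = n then 1 else 0, n, fun _ hj => if_neg hj.ne'⟩

instance : One (PDO T) := ⟨del T 0⟩

instance : Add (PDO T) := ⟨fun A B => ⟨A.coeff + B.coeff, by
  obtain ⟨N, hN⟩ := A.bdd
  obtain ⟨M, hM⟩ := B.bdd
  refine ⟨max N M, fun j hj => ?_⟩
  simp [hN j ((le_max_left _ _).trans_lt hj), hM j ((le_max_right _ _).trans_lt hj)]⟩⟩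

instance : Neg (PDO T) := ⟨fun A => ⟨-A.coeff, by
  obtain ⟨N, hN⟩ := A.bdd
  exact ⟨N, fun j hj => by simp [hN j hj]⟩⟩⟩

instance : Sub (PDO T) := ⟨fun A B => ⟨A.coeff - B.coeff, by
  obtain ⟨N, hN⟩ := A.bdd
  obtain ⟨M, hM⟩ := B.bdd
  refine ⟨max N M, fun j hj => ?_⟩
  simp [hN j ((le_max_left _ _).trans_lt hj), hM j ((le_max_right _ _).trans_lt hj)]⟩⟩

instance [Algebra ℚ R] : SMul ℚ (PDO T) := ⟨fun c A => ⟨fun j => c • A.coeff j, by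
  obtain ⟨N, hN⟩ := A.bdd
  exact ⟨N, fun j hj => by simp [hN j hj]⟩⟩⟩

/-- The term of `(a_i ∂^i) ∗ (∑_j b_j ∂^j)` at `∂^l` with `k` derivatives acting on `b`, from
`∂^i b = ∑_k binom(i, k) (∂_x^k b) ∂^{i-k}`. -/
def mulTerm [Algebra ℚ R] (A B : PDO T) (l : ℤ) (p : ℤ × ℕ) : Fn R :=
  (Ring.choose p.1 p.2 : ℤ) •
    Fn.star T (A.coeff p.1) ((Fn.dt T 1)^[p.2] (B.coeff (l - p.1 + p.2)))

/-- Only finitely many terms contribute to each coefficient of a product. -/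
theorem mulTerm_support_finite [Algebra ℚ R] (A B : PDO T) (l : ℤ) :
    (Function.support (mulTerm A B l)).Finite := by
  obtain ⟨N, hN⟩ := A.bdd
  obtain ⟨M, hM⟩ := B.bdd
  refine ((Set.finite_Icc (l - M) N).prod (Set.finite_Iic (M - l + N).toNat)).subset ?_
  rintro ⟨i, k⟩ h
  have h1 : i ≤ N := by
    by_contra hi
    exact h (by simp [mulTerm, hN i (not_le.mp hi)])
  have h2 : l - i + k ≤ M := by
    by_contra hj
    exact h (by simp [mulTerm, hM _ (not_le.mp hj), Fn.dt_iterate_zero])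
  simp only [Set.mem_prod, Set.mem_Icc, Set.mem_Iic]
  omega

/-- The product `A ∗ B`. -/
instance [Algebra ℚ R] : Mul (PDO T) := ⟨fun A B =>
  ⟨fun l => ∑ᶠ p : ℤ × ℕ, mulTerm A B l p, by
    obtain ⟨N, hN⟩ := A.bdd
    obtain ⟨M, hM⟩ := B.bdd
    refine ⟨N + M, fun l hl => ?_⟩
    rw [← finsum_zero (α := ℤ × ℕ)]
    refine finsum_congr fun p => ?_
    by_cases hp : N < p.1
    · simp [mulTerm, hN _ hp]
    · simp [mulTerm, hM (l - p.1 + p.2) (by omega), Fn.dt_iterate_zero]⟩⟩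

/-- Powers with respect to `∗`: `A^{n+1} = A^n ∗ A`. -/
def pow [Algebra ℚ R] (A : PDO T) : ℕ → PDO T
  | 0 => 1
  | n + 1 => pow A n * A

instance [Algebra ℚ R] : Pow (PDO T) ℕ := ⟨pow⟩

/-- The part `A_{≥0}`. -/
def nonnegPart (A : PDO T) : PDO T := ⟨fun j => if 0 ≤ j then A.coeff j else 0, by
  obtain ⟨N, hN⟩ := A.bdd
  exact ⟨N, fun j hj => by simp [hN j hj]⟩⟩

/-- The part `A_{<0}`. -/
def negPart (A : PDO T) : PDO T := ⟨fun j => if j < 0 then A.coeff j else 0, by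
  obtain ⟨N, hN⟩ := A.bdd
  exact ⟨N, fun j hj => by simp [hN j hj]⟩⟩

/-- `∂A/∂tₙ`, coefficientwise. -/
def dt (n : ℕ+) (A : PDO T) : PDO T := ⟨fun j => (A.coeff j).dt T n, by
  obtain ⟨N, hN⟩ := A.bdd
  exact ⟨N, fun j hj => by simp [hN j hj]⟩⟩

/-- `∂A/∂θ_{m,n}`, coefficientwise. -/
def dtheta (m n : ℕ+) (A : PDO T) : PDO T := ⟨fun j => (A.coeff j).dtheta m n, by
  obtain ⟨N, hN⟩ := A.bdd
  exact ⟨N, fun j hj => by simp [hN j hj]⟩⟩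

/-- `A = 1 + ∑_{i ≥ 1} a_i ∂^{-i}`. -/
def IsMonic (A : PDO T) : Prop := A.coeff 0 = 1 ∧ ∀ j, 0 < j → A.coeff j = 0

/-- The coefficients of `A` do not depend on `x = t₁`. -/
def XIndependent (A : PDO T) : Prop := A.dt 1 = 0

/-- The coefficients of `A` do not depend on any of the times. -/
def TIndependent (A : PDO T) : Prop := ∀ r, A.dt r = 0

variable [Algebra ℚ R]

/-- `[A, B]_∗` -/
def comm (A B : PDO T) : PDO T := A * B - B * A

/-- The ncKP hierarchy `L_{t_n} = [L^{(n)}, L]_∗`, `n = 1, 2, …`, where `L^{(n)} = (L^n)_{≥0}`. -/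
def NcKPHierarchy (L : PDO T) : Prop :=
  ∀ n : ℕ+, L.dt n = comm (L ^ (n : ℕ)).nonnegPart L

/-- `W^{(m,n)} = ½ (L̄^{(n)} ∗ L^{(m)} - L̄^{(m)} ∗ L^{(n)})_{≥0}`, where `L̄^{(n)} = (L^n)_{<0}`. -/
def W (L : PDO T) (m n : ℕ+) : PDO T :=
  ((1 / 2 : ℚ) • ((L ^ (n : ℕ)).negPart * (L ^ (m : ℕ)).nonnegPart
    - (L ^ (m : ℕ)).negPart * (L ^ (n : ℕ)).nonnegPart)).nonnegPart

/-- The deformation equation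
`L_{θ_{m,n}} = [W^{(m,n)}, L]_∗ + ½ (L_{t_n} ∗ L^{(m)} - L_{t_m} ∗ L^{(n)})`. -/
def DeformationEq (L : PDO T) (m n : ℕ+) : Prop :=
  L.dtheta m n = comm (W L m n) L
    + (1 / 2 : ℚ) • (L.dt n * (L ^ (m : ℕ)).nonnegPart - L.dt m * (L ^ (n : ℕ)).nonnegPart)

end PDO

/-! ## Dressing operators -/

/-- An operator `X = 1 + ∑_{i ≥ 1} w_i ∂^{-i}` together with its inverse with respect to `∗`. -/
structure Dressing {R : Type*} [Ring R] [Algebra ℚ R] (T : Times R) where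
  X : PDO T
  inv : PDO T
  monic : X.IsMonic
  mul_inv : X * inv = 1
  inv_mul : inv * X = 1

namespace Dressing

variable {R : Type*} [Ring R] [Algebra ℚ R] {T : Times R}

/-- `L = X ∗ ∂ ∗ X⁻¹` -/
def lax (φ : Dressing T) : PDO T := φ.X * PDO.del T 1 * φ.inv

/-- `X_{t_n} = -(X ∗ ∂^n ∗ X⁻¹)_{<0} ∗ X`, `n = 1, 2, …` -/
def NcKPHierarchy (φ : Dressing T) : Prop :=
  ∀ n : ℕ+, φ.X.dt n = -((φ.X * PDO.del T n * φ.inv).negPart * φ.X)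

/-- `X_{θ_{m,n}} = -½ (X_{t_m} ∗ ∂^n ∗ X⁻¹ - X_{t_n} ∗ ∂^m ∗ X⁻¹)_{<0} ∗ X` -/
def DeformationEq (φ : Dressing T) (m n : ℕ+) : Prop :=
  φ.X.dtheta m n = -((1 / 2 : ℚ) • ((φ.X.dt m * PDO.del T n * φ.inv
    - φ.X.dt n * PDO.del T m * φ.inv).negPart * φ.X))

/-- `X_{θ_{m,n}} = ½ (L̄^{(m)} ∗ L^n - L̄^{(n)} ∗ L^m)_{<0} ∗ X` with `L = X ∗ ∂ ∗ X⁻¹` -/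
def DeformationEqLax (φ : Dressing T) (m n : ℕ+) : Prop :=
  φ.X.dtheta m n = (1 / 2 : ℚ) • (((φ.lax ^ (m : ℕ)).negPart * φ.lax ^ (n : ℕ)
    - (φ.lax ^ (n : ℕ)).negPart * φ.lax ^ (m : ℕ)).negPart * φ.X)

end Dressing

end

end NcKP

namespace NcKP

noncomputable section

open Finsupp

section Functions

variable {R : Type*} [Ring R]

/-! Everything is measured by defects of the equations for `X`, written as right factors. Write P_n
= L^{(n)}, Q_n = (L^n)_{<0}, and define F_n and G_{m,n} by X_{t_n} = -Q_n X + X F_n and X_θ = Z_{<0}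
X + X G, where Z = ½(Q_m L^n - Q_n L^m). So F = 0 is (2) and G = 0 is (5). Differentiating L X = X ∂
shows that (1) for n holds iff F_n commutes with ∂ and, once F = 0, that (3) for (m, n) holds iff
G_{m,n} commutes with ∂ (`lax_dt_eq_iff`, `lax_deformationEq_iff`). Commuting with ∂ means being
independent of x. Hence the equations for L determine X only up to a right factor C with [∂, C] = 0,
and such a C has to be found that removes the defects: C_{t_n} = -F_n C, then C_θ = -G C.

These linear systems are solvable because they are flat. The operators D_n f = f_{t_n} - P_n f and
D_θ f = f_θ - W f - ½(P_m D_n f - P_n D_m f) preserve differential operators. Conjugated by X they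
become ∂_{t_n} - ∂^n + F_n and ∂_θ - ½(∂^m ∂_{t_n} - ∂^n ∂_{t_m}) + G (`covT_X_mul`,
`covTheta_X_mul`), whose undressed parts commute. A commutator of two of them applied to 1 = X X⁻¹
is therefore a differential operator of the form X K X⁻¹, where K is the curvature of F or G and has
negative order; so K = 0 (`eq_zero_of_isDifferential`). This yields flatness of F, flatness of G,
and, from [D_r, D_θ], the independence of G of every time once it is independent of x.

A flat connection of negative order has a monic horizontal section, built coefficient by coefficient
from a Poincaré lemma (`exists_horizontal`). In the θ directions the formal lemma suffices and its
primitives stay independent of the times, which gives (a) over every ring. In the t directions the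
lemma is proved for formal power series and for smooth functions, which gives (b); F_1 = 0 holds
identically, so there C does not depend on x. -/

theorem Times.D_one (T : Times R) (n : ℕ+) : T.D n 1 = 0 := by
  simpa using T.leibniz n 1 1

/-! ### Derivatives in the times and in θ, and the powers of the Poisson operator -/

namespace Fn

variable {T : Times R}

theorem dt_apply (n : ℕ+) (f : Fn R) (γ : Theta →₀ ℕ) : dt T n f γ = T.D n (f γ) := rfl

theorem dt_add (n : ℕ+) (f g : Fn R) : dt T n (f + g) = dt T n f + dt T n g :=
  funext fun γ => map_add (T.D n) (f γ) (g γ)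

theorem dt_comm (m n : ℕ+) (f : Fn R) : dt T m (dt T n f) = dt T n (dt T m f) :=
  funext fun γ => T.comm m n (f γ)

theorem dt_sum {ι : Type*} (n : ℕ+) (s : Finset ι) (f : ι → Fn R) :
    dt T n (∑ i ∈ s, f i) = ∑ i ∈ s, dt T n (f i) :=
  map_sum (AddMonoidHom.mk' (dt T n) (dt_add n)) f s

theorem dt_one (n : ℕ+) : dt T n (1 : Fn R) = 0 := by
  classical
  funext γ
  change T.D n (MvPowerSeries.coeff γ (1 : Fn R)) = 0
  rw [MvPowerSeries.coeff_one]
  split_ifs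
  · exact T.D_one n
  · exact map_zero _

theorem mul_apply (f g : Fn R) (γ : Theta →₀ ℕ) :
    (f * g) γ = ∑ p ∈ Finset.HasAntidiagonal.antidiagonal γ, f p.1 * g p.2 :=
  MvPowerSeries.coeff_mul γ f g

theorem dt_mul (n : ℕ+) (f g : Fn R) : dt T n (f * g) = dt T n f * g + f * dt T n g := by
  funext γ
  rw [dt_apply, mul_apply, map_sum]
  refine Eq.trans ?_ (congrArg₂ (· + ·) (mul_apply (dt T n f) g γ) (mul_apply f (dt T n g) γ)).symm
  rw [← Finset.sum_add_distrib]
  exact Finset.sum_congr rfl fun p _ => T.leibniz _ _ _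

/-- `∂f/∂θ_q` for a label `q = (m, n)`, `m < n`. -/
abbrev pd (q : Theta) (f : Fn R) : Fn R := MvPowerSeries.pderivFun q f

theorem pd_apply (q : Theta) (f : Fn R) (γ : Theta →₀ ℕ) :
    pd q f γ = (γ q + 1) • f (γ + single q 1) := by
  refine (MvPowerSeries.coeff_pderivFun f γ).trans ?_
  rw [nsmul_eq_mul, ← Nat.cast_succ, (Nat.cast_commute _ _).eq]
  rfl

theorem pd_add (q : Theta) (f g : Fn R) : pd q (f + g) = pd q f + pd q g :=
  MvPowerSeries.pderivFun_add f g

theorem pd_one (q : Theta) : pd q (1 : Fn R) = 0 := MvPowerSeries.pderivFun_one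

theorem pd_dt (q : Theta) (n : ℕ+) (f : Fn R) : pd q (dt T n f) = dt T n (pd q f) := by
  funext γ
  simp only [pd_apply, dt_apply, map_nsmul]

theorem pd_comm (p q : Theta) (f : Fn R) : pd p (pd q f) = pd q (pd p f) := by
  funext γ
  by_cases h : p = q
  · rw [h]
  · have h' : q ≠ p := fun e => h e.symm
    simp only [pd_apply, Finsupp.add_apply, single_eq_of_ne h, single_eq_of_ne h', add_zero,
      smul_smul]
    rw [add_right_comm, mul_comm]

/-- Terms in which the first exponent lacks q have weight zero; the others arise uniquely by adding
q to a first exponent. With its mirror image below this is the Leibniz rule for `pd`, since the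
total exponent of q is the sum of the two weights. -/
theorem sum_antidiagonal_fst_nsmul (f g : Fn R) (q : Theta) (γ : Theta →₀ ℕ) :
    ∑ p ∈ Finset.HasAntidiagonal.antidiagonal (γ + single q 1 : Theta →₀ ℕ), (p.1 q) • (f p.1 * g p.2) =
      ∑ p ∈ Finset.HasAntidiagonal.antidiagonal γ, (p.1 q + 1) • (f (p.1 + single q 1) * g p.2) := by
  symm
  refine Finset.sum_of_injOn (fun p => (p.1 + single q 1, p.2)) ?_ ?_ ?_ ?_
  · rintro ⟨a, b⟩ - ⟨c, d⟩ - h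
    simpa using h
  · rintro ⟨a, b⟩ h
    simp only [Finset.mem_coe, Finset.HasAntidiagonal.mem_antidiagonal] at h ⊢
    rw [← h, add_right_comm]
  · rintro ⟨a, b⟩ h hn
    have : a q = 0 := by
      by_contra h0
      refine hn ⟨(a - single q 1, b), ?_, ?_⟩
      · have hle : single q 1 ≤ a := by
          rw [Finsupp.single_le_iff]; omega
        simp only [Finset.mem_coe, Finset.HasAntidiagonal.mem_antidiagonal] at h ⊢
        rw [← add_left_inj (single q 1), ← h, add_right_comm, tsub_add_cancel_of_le hle]
      · have hle : single q 1 ≤ a := by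
          rw [Finsupp.single_le_iff]; omega
        simp [tsub_add_cancel_of_le hle]
    simp [this]
  · rintro ⟨a, b⟩ -
    simp

theorem sum_antidiagonal_snd_nsmul (f g : Fn R) (q : Theta) (γ : Theta →₀ ℕ) :
    ∑ p ∈ Finset.HasAntidiagonal.antidiagonal (γ + single q 1 : Theta →₀ ℕ), (p.2 q) • (f p.1 * g p.2) =
      ∑ p ∈ Finset.HasAntidiagonal.antidiagonal γ, (p.2 q + 1) • (f p.1 * g (p.2 + single q 1)) := by
  symm
  refine Finset.sum_of_injOn (fun p => (p.1, p.2 + single q 1)) ?_ ?_ ?_ ?_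
  · rintro ⟨a, b⟩ - ⟨c, d⟩ - h
    simpa using h
  · rintro ⟨a, b⟩ h
    simp only [Finset.mem_coe, Finset.HasAntidiagonal.mem_antidiagonal] at h ⊢
    rw [← h, add_assoc]
  · rintro ⟨a, b⟩ h hn
    have : b q = 0 := by
      by_contra h0
      refine hn ⟨(a, b - single q 1), ?_, ?_⟩
      · have hle : single q 1 ≤ b := by
          rw [Finsupp.single_le_iff]; omega
        simp only [Finset.mem_coe, Finset.HasAntidiagonal.mem_antidiagonal] at h ⊢
        rw [← add_left_inj (single q 1), ← h, add_assoc, tsub_add_cancel_of_le hle]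
      · have hle : single q 1 ≤ b := by
          rw [Finsupp.single_le_iff]; omega
        simp [tsub_add_cancel_of_le hle]
    simp [this]
  · rintro ⟨a, b⟩ -
    simp

theorem pd_mul (q : Theta) (f g : Fn R) : pd q (f * g) = pd q f * g + f * pd q g := by
  funext γ
  rw [pd_apply, mul_apply]
  refine Eq.trans ?_ (congrArg₂ (· + ·) (mul_apply (pd q f) g γ) (mul_apply f (pd q g) γ)).symm
  simp only [pd_apply, smul_mul_assoc, mul_smul_comm]
  rw [← sum_antidiagonal_fst_nsmul, ← sum_antidiagonal_snd_nsmul, ← Finset.sum_add_distrib,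
    Finset.smul_sum]
  refine Finset.sum_congr rfl fun p hp => ?_
  rw [← add_smul, ← Finsupp.add_apply, Finset.HasAntidiagonal.mem_antidiagonal.mp hp]
  simp

/-- The power series `∑_q θ_q H_q`. -/
def thetaSum (H : Theta → Fn R) : Fn R := fun γ => ∑ q ∈ γ.support, H q (γ - single q 1)

theorem poisson_succ (k : ℕ) (f g : Fn R) :
    poisson T (k + 1) f g = thetaSum fun q =>
      poisson T k (f.dt T q.1.1) (g.dt T q.1.2) - poisson T k (f.dt T q.1.2) (g.dt T q.1.1) :=
  rfl

theorem thetaSum_add (G H : Theta → Fn R) : thetaSum (G + H) = thetaSum G + thetaSum H :=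
  funext fun _ => Finset.sum_add_distrib

theorem dt_thetaSum (n : ℕ+) (H : Theta → Fn R) :
    dt T n (thetaSum H) = thetaSum fun q => dt T n (H q) :=
  funext fun _ => map_sum _ _ _

/-- The product rule for θ_q H_q, where ∂θ_q/∂θ_p is 1 or 0. On coefficients the term q = p must be
separated: its weight γ p + 1 is split into γ p, for the derivative of H_p, and 1, for H_p itself.
-/
theorem pd_thetaSum (p : Theta) (H : Theta → Fn R) :
    pd p (thetaSum H) = thetaSum (fun q => pd p (H q)) + H p := by
  classical
  funext γ
  have key : ∀ q, q ≠ p → γ q ≠ 0 →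
      pd p (H q) (γ - single q 1) = (γ p + 1) • H q (γ + single p 1 - single q 1) := by
    intro q hq h0
    have hle : single q 1 ≤ γ := by rw [Finsupp.single_le_iff]; omega
    rw [pd_apply, tsub_add_eq_add_tsub hle]
    simp [Finsupp.single_eq_of_ne hq.symm]
  have hp : p ∈ (γ + single p 1).support := by simp
  have hs : (γ + single p 1).support.erase p = γ.support.erase p := by
    ext q
    by_cases h : q = p
    · simp [h]
    · simp [h, Finsupp.single_eq_of_ne h]
  change pd p (thetaSum H) γ = thetaSum (fun q => pd p (H q)) γ + H p γ
  rw [pd_apply, thetaSum, thetaSum, ← Finset.add_sum_erase _ _ hp, hs, smul_add, Finset.smul_sum,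
    add_tsub_cancel_right]
  have h1 : ∑ q ∈ γ.support.erase p, (γ p + 1) • H q (γ + single p 1 - single q 1) =
      ∑ q ∈ γ.support.erase p, pd p (H q) (γ - single q 1) := by
    refine Finset.sum_congr rfl fun q hq => (key q (Finset.ne_of_mem_erase hq) ?_).symm
    exact Finsupp.mem_support_iff.mp (Finset.mem_of_mem_erase hq)
  rw [h1]
  -- If p does not occur in γ, the sum over the support of γ has no term at p, and only H_p remains.
  by_cases h : γ p = 0
  · rw [Finset.erase_eq_of_notMem (by simp [h]), h, zero_add, one_smul, add_comm]
  · rw [← Finset.add_sum_erase γ.support _ (Finsupp.mem_support_iff.mpr h), pd_apply,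
      tsub_add_cancel_of_le (by rw [Finsupp.single_le_iff]; omega)]
    simp only [Finsupp.tsub_apply, single_eq_same]
    rw [Nat.sub_add_cancel (by omega), add_smul, one_smul]
    abel

theorem poisson_add_left (k : ℕ) (f f' g : Fn R) :
    poisson T k (f + f') g = poisson T k f g + poisson T k f' g := by
  induction k generalizing f f' g with
  | zero => exact add_mul _ _ _
  | succ k ih =>
    simp only [poisson_succ, dt_add, ih]
    rw [← thetaSum_add]
    congr 1
    funext q
    simp only [Pi.add_apply]
    abel

theorem poisson_add_right (k : ℕ) (f g g' : Fn R) :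
    poisson T k f (g + g') = poisson T k f g + poisson T k f g' := by
  induction k generalizing f g g' with
  | zero => exact mul_add _ _ _
  | succ k ih =>
    simp only [poisson_succ, dt_add, ih]
    rw [← thetaSum_add]
    congr 1
    funext q
    simp only [Pi.add_apply]
    abel

theorem dt_sub (n : ℕ+) (f g : Fn R) : dt T n (f - g) = dt T n f - dt T n g :=
  funext fun γ => map_sub (T.D n) (f γ) (g γ)

theorem dt_poisson (n : ℕ+) (k : ℕ) (f g : Fn R) :
    dt T n (poisson T k f g) = poisson T k (dt T n f) g + poisson T k f (dt T n g) := by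
  induction k generalizing f g with
  | zero => exact dt_mul _ _ _
  | succ k ih =>
    simp only [poisson_succ, dt_thetaSum, dt_sub, ih]
    rw [← thetaSum_add]
    congr 1
    funext q
    simp only [Pi.add_apply, dt_comm n]
    abel

theorem pd_sub (q : Theta) (f g : Fn R) : pd q (f - g) = pd q f - pd q g := by
  rw [eq_sub_iff_add_eq, ← pd_add, sub_add_cancel]

theorem thetaSum_nsmul (n : ℕ) (H : Theta → Fn R) : thetaSum (n • H) = n • thetaSum H :=
  funext fun γ => (Finset.smul_sum (r := n) (s := γ.support)
    (f := fun q => H q (γ - single q 1))).symm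

theorem pd_poisson_zero (q : Theta) (f g : Fn R) :
    pd q (poisson T 0 f g) = poisson T 0 (pd q f) g + poisson T 0 f (pd q g) :=
  pd_mul _ _ _

/-- P is linear in θ and its constant-coefficient parts commute, so ∂P^{k+1} = (k+1) P^k ∂P. In the
induction the outermost factor P contributes one copy and the inductive hypothesis the others. -/
theorem pd_poisson_succ (q : Theta) (k : ℕ) (f g : Fn R) :
    pd q (poisson T (k + 1) f g) = poisson T (k + 1) (pd q f) g + poisson T (k + 1) f (pd q g) +
      (k + 1) • (poisson T k (f.dt T q.1.1) (g.dt T q.1.2) -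
        poisson T k (f.dt T q.1.2) (g.dt T q.1.1)) := by
  induction k generalizing f g with
  | zero =>
    rw [poisson_succ, pd_thetaSum, zero_add, one_smul, poisson_succ, poisson_succ, ← thetaSum_add]
    congr 2
    funext p
    simp only [pd_sub, pd_poisson_zero, pd_dt, Pi.add_apply]
    abel
  | succ k ih =>
    rw [poisson_succ, pd_thetaSum, succ_nsmul, ← add_assoc]
    congr 1
    rw [poisson_succ (k + 1), poisson_succ (k + 1), poisson_succ k, poisson_succ k,
      ← thetaSum_add, smul_sub,
      ← thetaSum_nsmul, ← thetaSum_nsmul, sub_eq_add_neg]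
    rw [show ∀ H : Theta → Fn R, -thetaSum H = thetaSum (-H) from fun H =>
      eq_comm.mp (eq_neg_of_add_eq_zero_left (by
        rw [← thetaSum_add, neg_add_cancel]; exact funext fun _ => Finset.sum_const_zero)),
      ← thetaSum_add, ← thetaSum_add]
    congr 1
    funext p
    simp only [pd_sub, ih, pd_dt, Pi.add_apply, Pi.neg_apply, Pi.smul_apply, dt_comm _ p.1.1, dt_comm _ p.1.2,
      smul_sub]
    abel

theorem dt_neg (n : ℕ+) (f : Fn R) : dt T n (-f) = -dt T n f :=
  funext fun γ => map_neg (T.D n) (f γ)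

theorem dtheta_of_lt {m n : ℕ+} (h : m < n) (f : Fn R) : dtheta m n f = pd ⟨(m, n), h⟩ f :=
  dif_pos h

theorem dtheta_swap (m n : ℕ+) (f : Fn R) : dtheta n m f = -dtheta m n f := by
  unfold dtheta
  rcases lt_trichotomy m n with h | rfl | h
  · rw [dif_neg h.not_gt, dif_pos h, dif_pos h]
  · simp
  · rw [dif_pos h, dif_neg h.not_gt, dif_pos h, neg_neg]

theorem dtheta_self (m : ℕ+) (f : Fn R) : dtheta m m f = 0 := by
  simp [dtheta]

/-- Statements about `∂_{θ_{m,n}}` compatible with `θ_{n,m} = -θ_{m,n}` may be checked for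
`m < n`. -/
theorem theta_induction {motive : ℕ+ → ℕ+ → Prop} (lt : ∀ m n, m < n → motive m n)
    (self : ∀ m, motive m m) (swap : ∀ m n, motive m n → motive n m) (m n : ℕ+) :
    motive m n := by
  rcases lt_trichotomy m n with h | rfl | h
  · exact lt _ _ h
  · exact self _
  · exact swap _ _ (lt _ _ h)

theorem dtheta_add (m n : ℕ+) (f g : Fn R) :
    dtheta m n (f + g) = dtheta m n f + dtheta m n g := by
  induction m, n using theta_induction with
  | lt m n h => simp only [dtheta_of_lt h, pd_add]
  | self m => simp [dtheta_self]
  | swap m n ih => rw [dtheta_swap m n, ih, dtheta_swap m n, dtheta_swap m n, neg_add]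

theorem dtheta_sum {ι : Type*} (m n : ℕ+) (s : Finset ι) (f : ι → Fn R) :
    dtheta m n (∑ i ∈ s, f i) = ∑ i ∈ s, dtheta m n (f i) :=
  map_sum (AddMonoidHom.mk' (dtheta m n) (dtheta_add m n)) f s

theorem dtheta_dt (m n r : ℕ+) (f : Fn R) :
    dtheta m n (dt T r f) = dt T r (dtheta m n f) := by
  induction m, n using theta_induction with
  | lt m n h => simp only [dtheta_of_lt h, pd_dt]
  | self m => simp [dtheta_self]
  | swap m n ih => rw [dtheta_swap m n, ih, dtheta_swap m n, dt_neg]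

theorem dtheta_neg (m n : ℕ+) (f : Fn R) : dtheta m n (-f) = -dtheta m n f := by
  rw [eq_neg_iff_add_eq_zero, ← dtheta_add, neg_add_cancel, dtheta_zero]

theorem dtheta_comm (m n k l : ℕ+) (f : Fn R) :
    dtheta m n (dtheta k l f) = dtheta k l (dtheta m n f) := by
  induction m, n using theta_induction with
  | lt m n h =>
    induction k, l using theta_induction with
    | lt k l h' => simp only [dtheta_of_lt h, dtheta_of_lt h', pd_comm]
    | self m => simp [dtheta_self]
    | swap k l ih => rw [dtheta_swap k l, dtheta_neg, ih, dtheta_swap k l]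
  | self m => simp [dtheta_self]
  | swap m n ih => rw [dtheta_swap m n, ih, dtheta_swap m n, dtheta_neg]

theorem dtheta_one (m n : ℕ+) : dtheta m n (1 : Fn R) = 0 := by
  induction m, n using theta_induction with
  | lt m n h => simp only [dtheta_of_lt h, pd_one]
  | self m => simp [dtheta_self]
  | swap m n ih => rw [dtheta_swap m n, ih, neg_zero]

end Fn

end Functions

/-! ### The Moyal product: Leibniz rules, associativity, unit -/

section Functions

variable {R : Type*} [Ring R] [Algebra ℚ R]

namespace Fn

variable {T : Times R}

theorem dt_smul (n : ℕ+) (c : ℚ) (f : Fn R) : dt T n (c • f) = c • dt T n f :=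
  funext fun γ => map_rat_smul (T.D n) c (f γ)

theorem poisson_smul_left (k : ℕ) (c : ℚ) (f g : Fn R) :
    poisson T k (c • f) g = c • poisson T k f g := by
  induction k generalizing f g with
  | zero => exact smul_mul_assoc _ _ _
  | succ k ih =>
    simp only [poisson_succ, dt_smul, ih, ← smul_sub]
    exact funext fun γ => (Finset.smul_sum (r := c) (s := γ.support)).symm

theorem poisson_smul_right (k : ℕ) (c : ℚ) (f g : Fn R) :
    poisson T k f (c • g) = c • poisson T k f g := by
  induction k generalizing f g with
  | zero => exact mul_smul_comm _ _ _
  | succ k ih =>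
    simp only [poisson_succ, dt_smul, ih, ← smul_sub]
    exact funext fun γ => (Finset.smul_sum (r := c) (s := γ.support)).symm

/-- The coefficient `1 / (2ᵏ k!)` of the Moyal product. -/
def moyalCoeff (k : ℕ) : ℚ := 1 / (2 ^ k * k.factorial)

/-- The differential equation of exp(P/2) on coefficients: the factor k + 1 from differentiating
P^{k+1} becomes ½ in front of the weight of P^k. -/
theorem moyalCoeff_succ (k : ℕ) : moyalCoeff (k + 1) * (k + 1) = 1 / 2 * moyalCoeff k := by
  have : (k.factorial : ℚ) ≠ 0 := by exact_mod_cast k.factorial_ne_zero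
  unfold moyalCoeff
  rw [Nat.factorial_succ]
  push_cast
  field_simp
  ring

/-- The cutoff may be chosen freely above the degree, so that products evaluated in different
degrees can be compared term by term. -/
theorem star_apply (f g : Fn R) (γ : Theta →₀ ℕ) {n : ℕ} (h : γ.degree < n) :
    star T f g γ = ∑ k ∈ Finset.range n, moyalCoeff k • poisson T k f g γ := by
  refine Finset.sum_subset (Finset.range_subset_range.mpr h) fun k _ hk => ?_
  rw [poisson_eq_zero_of_degree_lt, smul_zero]
  simpa using hk

variable (T) in
/-- The Moyal product as a bilinear map. -/
def starₗ : Fn R →ₗ[ℚ] Fn R →ₗ[ℚ] Fn R :=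
  LinearMap.mk₂ ℚ (star T)
    (fun f f' g => funext fun γ => by
      simp only [star, poisson_add_left]
      exact (Finset.sum_congr rfl fun k _ => smul_add _ _ _).trans Finset.sum_add_distrib)
    (fun c f g => funext fun γ => by
      simp only [star, poisson_smul_left]
      refine Eq.trans ?_ (Finset.smul_sum (r := c)).symm
      exact Finset.sum_congr rfl fun k _ => smul_comm _ _ _)
    (fun f g g' => funext fun γ => by
      simp only [star, poisson_add_right]
      exact (Finset.sum_congr rfl fun k _ => smul_add _ _ _).trans Finset.sum_add_distrib)
    (fun c f g => funext fun γ => by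
      simp only [star, poisson_smul_right]
      refine Eq.trans ?_ (Finset.smul_sum (r := c)).symm
      exact Finset.sum_congr rfl fun k _ => smul_comm _ _ _)

theorem add_star (f f' g : Fn R) : star T (f + f') g = star T f g + star T f' g :=
  (starₗ T).map_add₂ f f' g

theorem star_add (f g g' : Fn R) : star T f (g + g') = star T f g + star T f g' :=
  (starₗ T f).map_add g g'

theorem sub_star (f f' g : Fn R) : star T (f - f') g = star T f g - star T f' g :=
  (starₗ T).map_sub₂ f f' g

theorem star_sub (f g g' : Fn R) : star T f (g - g') = star T f g - star T f g' :=
  (starₗ T f).map_sub g g'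

theorem smul_star (c : ℚ) (f g : Fn R) : star T (c • f) g = c • star T f g :=
  (starₗ T).map_smul₂ c f g

theorem star_smul (c : ℚ) (f g : Fn R) : star T f (c • g) = c • star T f g :=
  (starₗ T f).map_smul c g

theorem dt_star (n : ℕ+) (f g : Fn R) :
    dt T n (star T f g) = star T (dt T n f) g + star T f (dt T n g) := by
  funext γ
  refine (map_sum (T.D n) _ _).trans (Eq.trans ?_ Finset.sum_add_distrib)
  refine Finset.sum_congr rfl fun k _ => ?_
  rw [map_rat_smul (T.D n), ← smul_add]
  exact congrArg _ (congrFun (dt_poisson n k f g) γ)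

/-- This is the derivative of exp(P/2). Together with the value at θ = 0 it determines the product,
and it is all that associativity and the unit laws use. -/
theorem pd_star (q : Theta) (f g : Fn R) :
    pd q (star T f g) = star T (pd q f) g + star T f (pd q g) +
      (1 / 2 : ℚ) • (star T (f.dt T q.1.1) (g.dt T q.1.2) -
        star T (f.dt T q.1.2) (g.dt T q.1.1)) := by
  funext γ
  have h1 : (γ + single q 1).degree < γ.degree + 2 := by
    rw [map_add, degree_single]; omega
  have h0 : γ.degree < γ.degree + 2 := by omega
  have h0' : γ.degree < γ.degree + 1 := by omega
  -- The derivative at γ reads the coefficient at γ + q, one degree higher, hence the cutoff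
  -- `γ.degree + 2`.
  have hl : pd q (star T f g) γ = ∑ k ∈ Finset.range (γ.degree + 2),
      moyalCoeff k • pd q (poisson T k f g) γ := by
    rw [pd_apply, star_apply _ _ _ h1, Finset.smul_sum]
    refine Finset.sum_congr rfl fun k _ => ?_
    rw [pd_apply, smul_comm]
  have hz : pd q (poisson T 0 f g) γ = poisson T 0 (pd q f) g γ + poisson T 0 f (pd q g) γ :=
    congrFun (pd_poisson_zero q f g) γ
  have hs : ∀ k, pd q (poisson T (k + 1) f g) γ =
      poisson T (k + 1) (pd q f) g γ + poisson T (k + 1) f (pd q g) γ +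
      (k + 1) • (poisson T k (f.dt T q.1.1) (g.dt T q.1.2) γ -
        poisson T k (f.dt T q.1.2) (g.dt T q.1.1) γ) :=
    fun k => congrFun (pd_poisson_succ q k f g) γ
  have e : ∀ k, moyalCoeff (k + 1) • pd q (poisson T (k + 1) f g) γ =
      (moyalCoeff (k + 1) • poisson T (k + 1) (pd q f) g γ +
        moyalCoeff (k + 1) • poisson T (k + 1) f (pd q g) γ) +
      (1 / 2 : ℚ) • (moyalCoeff k • poisson T k (f.dt T q.1.1) (g.dt T q.1.2) γ -
        moyalCoeff k • poisson T k (f.dt T q.1.2) (g.dt T q.1.1) γ) := by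
    intro k
    rw [hs, smul_add, smul_add, ← smul_sub (moyalCoeff k), smul_smul, ← moyalCoeff_succ,
      ← Nat.cast_smul_eq_nsmul ℚ (k + 1), smul_smul]
    push_cast
    rfl
  rw [hl, Finset.sum_range_succ', Finset.sum_congr rfl fun k _ => e k, hz]
  change _ = star T (pd q f) g γ + star T f (pd q g) γ +
    (1 / 2 : ℚ) • (star T (f.dt T q.1.1) (g.dt T q.1.2) γ -
        star T (f.dt T q.1.2) (g.dt T q.1.1) γ)
  rw [star_apply (pd q f) g γ h0, star_apply f (pd q g) γ h0, star_apply _ _ γ h0',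
    star_apply _ _ γ h0', Finset.sum_range_succ' _ (γ.degree + 1),
    Finset.sum_range_succ' _ (γ.degree + 1), Finset.sum_add_distrib, Finset.sum_add_distrib,
    ← Finset.smul_sum, Finset.sum_sub_distrib, smul_add]
  abel

theorem eq_of_succ_nsmul_eq {M : Type*} [AddCommGroup M] [Module ℚ M] {n : ℕ} {x y : M}
    (h : (n + 1) • x = (n + 1) • y) : x = y := by
  rw [← Nat.cast_smul_eq_nsmul ℚ, ← Nat.cast_smul_eq_nsmul ℚ] at h
  exact (smul_right_inj (by positivity)).mp h

/-- Coefficients are determined by those of the derivatives. -/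
theorem apply_eq_of_pd {f g : Fn R} {d : ℕ}
    (h : ∀ q : Theta, ∀ γ : Theta →₀ ℕ, γ.degree = d → pd q f γ = pd q g γ)
    (γ : Theta →₀ ℕ) (hγ : γ.degree = d + 1) : f γ = g γ := by
  have h0 : γ ≠ 0 := by
    rintro rfl
    simp at hγ
  obtain ⟨q, hq⟩ := Finsupp.ne_iff.mp h0
  have hle : single q 1 ≤ γ := by
    rw [Finsupp.single_le_iff]
    exact Nat.one_le_iff_ne_zero.mpr hq
  obtain ⟨δ, rfl⟩ : ∃ δ, γ = δ + single q 1 := ⟨γ - single q 1, (tsub_add_cancel_of_le hle).symm⟩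
  rw [map_add, degree_single] at hγ
  have := h q δ (by omega)
  rw [pd_apply, pd_apply] at this
  exact eq_of_succ_nsmul_eq this

theorem star_apply_zero (f g : Fn R) : star T f g 0 = f 0 * g 0 := by
  rw [star_apply f g 0 (n := 1) (by simp), Finset.sum_range_one]
  have : moyalCoeff 0 = 1 := by simp [moyalCoeff]
  rw [this, one_smul]
  exact map_mul (MvPowerSeries.constantCoeff (σ := Theta) (R := R)) f g

/-- Both triple products agree at θ = 0 and have the same rule for ∂_θ: differentiate one factor, or
apply the bivector to one of the three pairs of factors. All terms are again triple products,
evaluated one degree lower, so induction on the degree in θ, for all f, g, h at once, closes the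
argument. -/
theorem star_assoc (f g h : Fn R) : star T (star T f g) h = star T f (star T g h) := by
  suffices H : ∀ d, ∀ f g h : Fn R, ∀ γ : Theta →₀ ℕ, γ.degree = d →
      star T (star T f g) h γ = star T f (star T g h) γ from
    funext fun γ => H _ f g h γ rfl
  intro d
  induction d with
  | zero =>
    intro f g h γ hγ
    rw [(degree_eq_zero_iff γ).mp hγ]
    simp only [star_apply_zero, mul_assoc]
  | succ d ih =>
    intro f g h
    refine apply_eq_of_pd fun q γ hγ => ?_
    simp only [pd_star, dt_star, add_star, star_add, sub_star, star_sub, smul_star, star_smul]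
    have ih' := fun f g h => ih f g h γ hγ
    change star T (star T (pd q f) g) h γ + star T (star T f (pd q g)) h γ + (1 / 2 : ℚ) •
        (star T (star T (dt T _ f) (dt T _ g)) h γ - star T (star T (dt T _ f) (dt T _ g)) h γ) +
        star T (star T f g) (pd q h) γ + (1 / 2 : ℚ) •
        (star T (star T (dt T _ f) g) (dt T _ h) γ + star T (star T f (dt T _ g)) (dt T _ h) γ -
        (star T (star T (dt T _ f) g) (dt T _ h) γ + star T (star T f (dt T _ g)) (dt T _ h) γ)) =
      star T (pd q f) (star T g h) γ + (star T f (star T (pd q g) h) γ +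
        star T f (star T g (pd q h)) γ + (1 / 2 : ℚ) •
        (star T f (star T (dt T _ g) (dt T _ h)) γ - star T f (star T (dt T _ g) (dt T _ h)) γ)) +
        (1 / 2 : ℚ) •
        (star T (dt T _ f) (star T (dt T _ g) h) γ + star T (dt T _ f) (star T g (dt T _ h)) γ -
        (star T (dt T _ f) (star T (dt T _ g) h) γ + star T (dt T _ f) (star T g (dt T _ h)) γ))
    simp only [ih', smul_sub, smul_add]
    abel

theorem one_star (f : Fn R) : star T 1 f = f := by
  suffices H : ∀ d, ∀ f : Fn R, ∀ γ : Theta →₀ ℕ, γ.degree = d → star T 1 f γ = f γ from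
    funext fun γ => H _ f γ rfl
  intro d
  induction d with
  | zero =>
    intro f γ hγ
    rw [(degree_eq_zero_iff γ).mp hγ, star_apply_zero]
    rw [show (1 : Fn R) 0 = 1 from MvPowerSeries.coeff_zero_one (σ := Theta) (R := R), one_mul]
  | succ d ih =>
    intro f
    refine apply_eq_of_pd fun q γ hγ => ?_
    simpa [pd_star, dt_one, pd_one] using ih (pd q f) γ hγ

theorem star_one (f : Fn R) : star T f 1 = f := by
  suffices H : ∀ d, ∀ f : Fn R, ∀ γ : Theta →₀ ℕ, γ.degree = d → star T f 1 γ = f γ from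
    funext fun γ => H _ f γ rfl
  intro d
  induction d with
  | zero =>
    intro f γ hγ
    rw [(degree_eq_zero_iff γ).mp hγ, star_apply_zero]
    rw [show (1 : Fn R) 0 = 1 from MvPowerSeries.coeff_zero_one (σ := Theta) (R := R), mul_one]
  | succ d ih =>
    intro f
    refine apply_eq_of_pd fun q γ hγ => ?_
    simpa [pd_star, dt_one, pd_one] using ih (pd q f) γ hγ

theorem dtheta_star (m n : ℕ+) (f g : Fn R) :
    dtheta m n (star T f g) = star T (dtheta m n f) g + star T f (dtheta m n g) +
      (1 / 2 : ℚ) • (star T (f.dt T m) (g.dt T n) - star T (f.dt T n) (g.dt T m)) := by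
  induction m, n using theta_induction with
  | lt m n h => simp only [dtheta_of_lt h, pd_star]
  | self m => simp [dtheta_self]
  | swap m n ih =>
    have hl : star T (-dtheta m n f) g = -star T (dtheta m n f) g := (starₗ T).map_neg₂ _ _
    have hr : star T f (-dtheta m n g) = -star T f (dtheta m n g) := (starₗ T f).map_neg _
    rw [dtheta_swap m n, ih, dtheta_swap m n, dtheta_swap m n, hl, hr,
      ← neg_sub (star T (f.dt T m) (g.dt T n)), smul_neg]
    abel

end Fn
end Functions

/-! ### The ring of formal pseudo-differential operators -/

namespace PDO

variable {R : Type*} [Ring R] {T : Times R}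

@[simp] theorem zero_coeff : (0 : PDO T).coeff = 0 := rfl
@[simp] theorem add_coeff (A B : PDO T) : (A + B).coeff = A.coeff + B.coeff := rfl
@[simp] theorem sub_coeff (A B : PDO T) : (A - B).coeff = A.coeff - B.coeff := rfl
@[simp] theorem neg_coeff (A : PDO T) : (-A).coeff = -A.coeff := rfl

instance : AddCommGroup (PDO T) where
  add_assoc A B C := PDO.ext (add_assoc _ _ _)
  zero_add A := PDO.ext (zero_add _)
  add_zero A := PDO.ext (add_zero _)
  add_comm A B := PDO.ext (add_comm _ _)
  neg_add_cancel A := PDO.ext (neg_add_cancel _)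
  sub_eq_add_neg A B := PDO.ext (sub_eq_add_neg _ _)
  nsmul := nsmulRec
  zsmul := zsmulRec

/-- `A` has order at most `N`. -/
def OrderLE (A : PDO T) (N : ℤ) : Prop := ∀ j, N < j → A.coeff j = 0

theorem OrderLE.mono {A : PDO T} {N M : ℤ} (h : A.OrderLE N) (hNM : N ≤ M) : A.OrderLE M :=
  fun j hj => h j (by omega)

theorem OrderLE.add {A B : PDO T} {N : ℤ} (hA : A.OrderLE N) (hB : B.OrderLE N) :
    (A + B).OrderLE N := fun j hj => by simp [hA j hj, hB j hj]

theorem OrderLE.sub {A B : PDO T} {N : ℤ} (hA : A.OrderLE N) (hB : B.OrderLE N) :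
    (A - B).OrderLE N := fun j hj => by simp [hA j hj, hB j hj]

theorem OrderLE.neg {A : PDO T} {N : ℤ} (hA : A.OrderLE N) : (-A).OrderLE N :=
  fun j hj => by simp [hA j hj]

theorem OrderLE.dt {A : PDO T} {N : ℤ} (hA : A.OrderLE N) (n : ℕ+) : (A.dt n).OrderLE N :=
  fun j hj => by simp [PDO.dt, hA j hj]

theorem OrderLE.dtheta {A : PDO T} {N : ℤ} (hA : A.OrderLE N) (m n : ℕ+) :
    (A.dtheta m n).OrderLE N :=
  fun j hj => by simp [PDO.dtheta, hA j hj]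

theorem dt_add (n : ℕ+) (A B : PDO T) : (A + B).dt n = A.dt n + B.dt n :=
  PDO.ext (funext fun _ => Fn.dt_add _ _ _)

theorem dtheta_add (m n : ℕ+) (A B : PDO T) :
    (A + B).dtheta m n = A.dtheta m n + B.dtheta m n :=
  PDO.ext (funext fun _ => Fn.dtheta_add _ _ _ _)

theorem dt_comm (m n : ℕ+) (A : PDO T) : (A.dt m).dt n = (A.dt n).dt m :=
  PDO.ext (funext fun _ => Fn.dt_comm _ _ _)

theorem dt_dtheta (m n r : ℕ+) (A : PDO T) : (A.dtheta m n).dt r = (A.dt r).dtheta m n :=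
  PDO.ext (funext fun _ => (Fn.dtheta_dt _ _ _ _).symm)

theorem dtheta_comm (m n k l : ℕ+) (A : PDO T) :
    (A.dtheta m n).dtheta k l = (A.dtheta k l).dtheta m n :=
  PDO.ext (funext fun _ => Fn.dtheta_comm _ _ _ _ _)

theorem dtheta_swap (m n : ℕ+) (A : PDO T) : A.dtheta n m = -A.dtheta m n :=
  PDO.ext (funext fun _ => Fn.dtheta_swap _ _ _)

theorem dtheta_self (m : ℕ+) (A : PDO T) : A.dtheta m m = 0 :=
  PDO.ext (funext fun _ => Fn.dtheta_self _ _)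

@[simp] theorem dt_del (n : ℕ+) (m : ℕ) : (del T m).dt n = 0 := by
  refine PDO.ext (funext fun j => ?_)
  by_cases h : j = m <;> simp [dt, del, h, Fn.dt_one]

@[simp] theorem dtheta_del (k l : ℕ+) (m : ℕ) : (del T m).dtheta k l = 0 := by
  refine PDO.ext (funext fun j => ?_)
  by_cases h : j = m <;> simp [dtheta, del, h, Fn.dtheta_one]

/-- The coefficient at `∂^l` of `∂^i ∗ B`. -/
def shiftCoeff (i : ℤ) (B : PDO T) (l : ℤ) : Fn R :=
  ∑ᶠ k : ℕ, (Ring.choose i k : ℤ) • (Fn.dt T 1)^[k] (B.coeff (l - i + k))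

theorem shiftCoeff_eq_sum {B : PDO T} {M : ℤ} (hB : B.OrderLE M) (i l : ℤ) {K : ℕ}
    (hK : M - l + i < K) :
    shiftCoeff i B l =
      ∑ k ∈ Finset.range K, (Ring.choose i k : ℤ) • (Fn.dt T 1)^[k] (B.coeff (l - i + k)) := by
  refine finsum_eq_sum_of_support_subset _ fun k hk => ?_
  by_contra h
  simp only [Finset.coe_range, Set.mem_Iio, not_lt] at h
  exact hk (by simp [hB (l - i + k) (by omega), Fn.dt_iterate_zero])

theorem shiftCoeff_eq_zero {B : PDO T} {M : ℤ} (hB : B.OrderLE M) {i l : ℤ} (h : M + i < l) :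
    shiftCoeff i B l = 0 := by
  rw [shiftCoeff_eq_sum hB i l (K := 0) (by simp; omega), Finset.sum_range_zero]

theorem shiftCoeff_zero_left (B : PDO T) (l : ℤ) : shiftCoeff 0 B l = B.coeff l := by
  rw [shiftCoeff, finsum_eq_single _ 0 fun k hk => by
    rw [Ring.choose_zero_pos _ (Nat.pos_of_ne_zero hk), zero_smul]]
  simp

/-- Pascal's rule for binom(i + 1, k), with i any integer: this is ∂^{i+1} B = ∂ (∂^i B). -/
theorem shiftCoeff_succ (i : ℤ) (B : PDO T) (l : ℤ) :
    shiftCoeff (i + 1) B l = shiftCoeff i B (l - 1) + Fn.dt T 1 (shiftCoeff i B l) := by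
  obtain ⟨M, hM⟩ : ∃ M, B.OrderLE M := B.bdd
  obtain ⟨K, hK⟩ : ∃ K : ℕ, M - l + i < K := ⟨(M - l + i + 1).toNat, by omega⟩
  rw [shiftCoeff_eq_sum hM (i + 1) l (K := K + 1) (by push_cast; omega),
    shiftCoeff_eq_sum hM i (l - 1) (K := K + 1) (by push_cast; omega),
    shiftCoeff_eq_sum hM i l hK]
  have hsum : Fn.dt T 1 (∑ k ∈ Finset.range K,
      (Ring.choose i k : ℤ) • (Fn.dt T 1)^[k] (B.coeff (l - i + k))) =
      ∑ k ∈ Finset.range K, (Ring.choose i k : ℤ) •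
        (Fn.dt T 1)^[k + 1] (B.coeff (l - i + k)) := by
    refine (map_sum (AddMonoidHom.mk' (Fn.dt T 1) (Fn.dt_add 1)) _ _).trans
      (Finset.sum_congr rfl fun k _ => ?_)
    rw [map_zsmul, Function.iterate_succ_apply']
    rfl
  rw [hsum, Finset.sum_range_succ', Finset.sum_range_succ' _ K, add_right_comm,
    ← Finset.sum_add_distrib]
  congr 1
  · refine Finset.sum_congr rfl fun k _ => ?_
    have e1 : l - (i + 1) + ((k + 1 : ℕ) : ℤ) = l - i + k := by push_cast; ring
    have e2 : l - 1 - i + ((k + 1 : ℕ) : ℤ) = l - i + k := by push_cast; ring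
    rw [Ring.choose_succ_succ, add_smul, e1, e2, add_comm]
  · simp only [Ring.choose_zero_right]
    congr 3
    ring

/-- The weights in ∂^i B are integers, so any additive map commuting with ∂_x passes through. It is
applied to ∂_{t_n} and ∂_θ. -/
theorem map_shiftCoeff (φ : Fn R →+ Fn R) (hφ : ∀ f, φ (Fn.dt T 1 f) = Fn.dt T 1 (φ f))
    {B B' : PDO T} (hB : ∀ j, B'.coeff j = φ (B.coeff j)) (i l : ℤ) :
    φ (shiftCoeff i B l) = shiftCoeff i B' l := by
  obtain ⟨M, hM⟩ : ∃ M, B.OrderLE M := B.bdd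
  have hM' : B'.OrderLE M := fun j hj => by rw [hB, hM j hj, map_zero]
  obtain ⟨K, hK⟩ : ∃ K : ℕ, M - l + i < K := ⟨(M - l + i + 1).toNat, by omega⟩
  rw [shiftCoeff_eq_sum hM i l hK, shiftCoeff_eq_sum hM' i l hK, map_sum]
  refine Finset.sum_congr rfl fun k _ => ?_
  rw [map_zsmul, hB, (Function.Semiconj.iterate_right (f := φ) hφ k).eq]

theorem dt_shiftCoeff (n : ℕ+) (i : ℤ) (B : PDO T) (l : ℤ) :
    Fn.dt T n (shiftCoeff i B l) = shiftCoeff i (B.dt n) l :=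
  map_shiftCoeff (AddMonoidHom.mk' (Fn.dt T n) (Fn.dt_add n)) (Fn.dt_comm n 1)
    (fun _ => rfl) i l

theorem dtheta_shiftCoeff (m n : ℕ+) (i : ℤ) (B : PDO T) (l : ℤ) :
    Fn.dtheta m n (shiftCoeff i B l) = shiftCoeff i (B.dtheta m n) l :=
  map_shiftCoeff (T := T) (B := B) (B' := B.dtheta m n)
    (AddMonoidHom.mk' (Fn.dtheta m n) (Fn.dtheta_add m n)) (Fn.dtheta_dt m n 1) (fun _ => rfl) i l

theorem shiftCoeff_add (i : ℤ) (B B' : PDO T) (l : ℤ) :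
    shiftCoeff i (B + B') l = shiftCoeff i B l + shiftCoeff i B' l := by
  obtain ⟨M, hM⟩ : ∃ M, B.OrderLE M := B.bdd
  obtain ⟨M', hM'⟩ : ∃ M, B'.OrderLE M := B'.bdd
  have h1 := hM.mono (le_max_left M M')
  have h2 := hM'.mono (le_max_right M M')
  obtain ⟨K, hK⟩ : ∃ K : ℕ, max M M' - l + i < K := ⟨(max M M' - l + i + 1).toNat, by omega⟩
  rw [shiftCoeff_eq_sum h1 i l hK, shiftCoeff_eq_sum h2 i l hK,
    shiftCoeff_eq_sum (h1.add h2) i l hK, ← Finset.sum_add_distrib]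
  refine Finset.sum_congr rfl fun k _ => ?_
  rw [← smul_add]
  congr 1
  exact iterate_map_add (AddMonoidHom.mk' (Fn.dt T 1) (Fn.dt_add 1)) k _ _

theorem shiftCoeff_del (i : ℤ) (n : ℕ) (l : ℤ) :
    shiftCoeff i (del T n) l = if l = i + n then 1 else 0 := by
  rw [shiftCoeff, finsum_eq_single _ 0 fun k hk => ?_]
  · have : l - i = n ↔ l = i + n := by omega
    simp [del, this]
  · obtain ⟨k, rfl⟩ := Nat.exists_eq_succ_of_ne_zero hk
    rw [Function.iterate_succ_apply]
    have : Fn.dt T 1 ((del T n).coeff (l - i + (k + 1 : ℕ))) = 0 :=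
      congrFun (congrArg PDO.coeff (dt_del (T := T) 1 n)) _
    rw [Nat.succ_eq_add_one, this, Fn.dt_iterate_zero, smul_zero]

/-- The operator `∂^i ∗ B`. -/
def shift (i : ℤ) (B : PDO T) : PDO T := ⟨shiftCoeff i B, by
  obtain ⟨M, hM⟩ := B.bdd
  exact ⟨M + i, fun l hl => shiftCoeff_eq_zero hM hl⟩⟩

theorem OrderLE.shift {B : PDO T} {M : ℤ} (hB : B.OrderLE M) (i : ℤ) :
    (B.shift i).OrderLE (M + i) := fun _ hl => shiftCoeff_eq_zero hB hl

theorem shift_one_coeff (B : PDO T) (l : ℤ) :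
    (B.shift 1).coeff l = B.coeff (l - 1) + Fn.dt T 1 (B.coeff l) := by
  change shiftCoeff 1 B l = _
  have := shiftCoeff_succ 0 B l
  rwa [shiftCoeff_zero_left, shiftCoeff_zero_left] at this

theorem shift_zero (B : PDO T) : B.shift 0 = B :=
  PDO.ext (funext fun l => shiftCoeff_zero_left B l)

theorem shift_succ (i : ℤ) (B : PDO T) : B.shift (i + 1) = (B.shift i).shift 1 := by
  refine PDO.ext (funext fun l => ?_)
  rw [shift_one_coeff]
  exact shiftCoeff_succ i B l

/-- The coefficient of ∂A at l is A_{l-1} + ∂_x A_l, so the coefficients of A are recovered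
downwards from a common bound on the orders. Injectivity carries identities from ∂^i to ∂^{i-1}. -/
theorem shift_one_injective : Function.Injective (shift 1 : PDO T → PDO T) := by
  intro A B h
  obtain ⟨N, hN⟩ : ∃ N, A.OrderLE N := A.bdd
  obtain ⟨M, hM⟩ : ∃ M, B.OrderLE M := B.bdd
  have key : ∀ n : ℕ, A.coeff (max N M + 1 - n) = B.coeff (max N M + 1 - n) := by
    intro n
    induction n with
    | zero => rw [hN _ (by simp), hM _ (by simp)]
    | succ n ih =>
      have := congrFun (congrArg PDO.coeff h) (max N M + 1 - n)
      rw [shift_one_coeff, shift_one_coeff, ih, add_left_inj] at this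
      push_cast
      rwa [← sub_sub]
  refine PDO.ext (funext fun l => ?_)
  by_cases hl : max N M < l
  · rw [hN _ (by omega), hM _ (by omega)]
  · have := key (max N M + 1 - l).toNat
    rwa [Int.toNat_of_nonneg (by omega), sub_sub_cancel] at this

theorem del_orderLE (n : ℕ) : (del T n).OrderLE n := fun _ hj => if_neg hj.ne'

theorem one_coeff (j : ℤ) : (1 : PDO T).coeff j = if j = 0 then 1 else 0 := rfl

theorem one_orderLE : (1 : PDO T).OrderLE 0 := del_orderLE 0

variable [Algebra ℚ R]

theorem star_sum {ι : Type*} (s : Finset ι) (f : Fn R) (g : ι → Fn R) :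
    Fn.star T f (∑ i ∈ s, g i) = ∑ i ∈ s, Fn.star T f (g i) :=
  map_sum (Fn.starₗ T f) g s

theorem sum_star {ι : Type*} (s : Finset ι) (f : ι → Fn R) (g : Fn R) :
    Fn.star T (∑ i ∈ s, f i) g = ∑ i ∈ s, Fn.star T (f i) g :=
  (Fn.starₗ T).map_sum₂ s f g

/-- The coefficients of a product as finite sums. -/
theorem mul_coeff_eq_sum {A B : PDO T} {N M : ℤ} (hA : A.OrderLE N) (hB : B.OrderLE M) {l : ℤ}
    {a b : ℤ} (ha : a ≤ l - M) (hb : N ≤ b) :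
    (A * B).coeff l = ∑ i ∈ Finset.Icc a b, Fn.star T (A.coeff i) (shiftCoeff i B l) := by
  obtain ⟨K, hK⟩ : ∃ K : ℕ, M - l + N < K := ⟨(M - l + N + 1).toNat, by omega⟩
  have h1 : (A * B).coeff l = ∑ p ∈ Finset.Icc a b ×ˢ Finset.range K, mulTerm A B l p := by
    refine finsum_eq_sum_of_support_subset _ ?_
    rintro ⟨i, k⟩ h
    have h1 : i ≤ N := by
      by_contra hi
      exact h (by simp [mulTerm, hA i (not_le.mp hi)])
    have h2 : l - i + k ≤ M := by
      by_contra hj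
      exact h (by simp [mulTerm, hB _ (not_le.mp hj), Fn.dt_iterate_zero])
    simp only [Finset.coe_product, Set.mem_prod, Finset.coe_Icc, Set.mem_Icc, Finset.coe_range,
      Set.mem_Iio]
    omega
  rw [h1, Finset.sum_product]
  refine Finset.sum_congr rfl fun i _ => ?_
  by_cases hi : N < i
  · simp [mulTerm, hA i hi]
  · rw [shiftCoeff_eq_sum hB i l (K := K) (by omega), star_sum]
    refine Finset.sum_congr rfl fun k _ => ?_
    exact (map_zsmul (Fn.starₗ T (A.coeff i)) _ _).symm

theorem OrderLE.mul {A B : PDO T} {N M : ℤ} (hA : A.OrderLE N) (hB : B.OrderLE M) :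
    (A * B).OrderLE (N + M) := by
  intro l hl
  rw [mul_coeff_eq_sum hA hB le_rfl le_rfl, Finset.Icc_eq_empty (by omega), Finset.sum_empty]

/-- Associativity with left factor ∂. Differentiating b_i ⋆ (∂^i C) gives one term with ∂_x b_i and
one with ∂_x (∂^i C); the latter combines with the lowered coefficient into b_i ⋆ (∂^{i+1} C). -/
theorem shift_one_mul (B C : PDO T) : (B * C).shift 1 = B.shift 1 * C := by
  obtain ⟨N, hN⟩ : ∃ N, B.OrderLE N := B.bdd
  obtain ⟨M, hM⟩ : ∃ M, C.OrderLE M := C.bdd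
  refine PDO.ext (funext fun l => ?_)
  rw [shift_one_coeff, mul_coeff_eq_sum (l := l) hN hM (a := l - M) (b := N + 1) le_rfl (by omega),
    mul_coeff_eq_sum (l := l - 1) hN hM (a := l - M - 1) (b := N) (by omega) le_rfl,
    mul_coeff_eq_sum (l := l) (hN.shift 1) hM (a := l - M) (b := N + 1) le_rfl (by omega)]
  have hd : Fn.dt T 1 (∑ i ∈ Finset.Icc (l - M) (N + 1),
      Fn.star T (B.coeff i) (shiftCoeff i C l)) =
      ∑ i ∈ Finset.Icc (l - M) (N + 1),
        (Fn.star T (Fn.dt T 1 (B.coeff i)) (shiftCoeff i C l) +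
          Fn.star T (B.coeff i) (Fn.dt T 1 (shiftCoeff i C l))) := by
    rw [Fn.dt_sum]
    exact Finset.sum_congr rfl fun i _ => Fn.dt_star _ _ _
  have hs : ∑ i ∈ Finset.Icc (l - M) (N + 1), Fn.star T (B.coeff (i - 1)) (shiftCoeff i C l) =
      ∑ i ∈ Finset.Icc (l - M - 1) N, Fn.star T (B.coeff i) (shiftCoeff (i + 1) C l) := by
    refine Finset.sum_nbij' (fun i => i - 1) (fun i => i + 1) ?_ ?_ ?_ ?_ ?_ <;> intro i hi <;>
      simp only [Finset.mem_Icc, sub_add_cancel, add_sub_cancel_right] at hi ⊢ <;> omega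
  -- The two ranges differ only at their ends, where b_i or the coefficient of ∂^i C vanishes by
  -- order.
  have hext : ∑ i ∈ Finset.Icc (l - M) (N + 1),
        Fn.star T (B.coeff i) (Fn.dt T 1 (shiftCoeff i C l)) =
      ∑ i ∈ Finset.Icc (l - M - 1) N, Fn.star T (B.coeff i) (Fn.dt T 1 (shiftCoeff i C l)) := by
    have h1 : ∑ i ∈ Finset.Icc (l - M) N,
        Fn.star T (B.coeff i) (Fn.dt T 1 (shiftCoeff i C l)) =
      ∑ i ∈ Finset.Icc (l - M) (N + 1),
        Fn.star T (B.coeff i) (Fn.dt T 1 (shiftCoeff i C l)) := by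
      refine Finset.sum_subset (Finset.Icc_subset_Icc le_rfl (by omega)) fun i hi hn => ?_
      simp only [Finset.mem_Icc] at hi hn
      rw [hN i (by omega), Fn.zero_star]
    have h2 : ∑ i ∈ Finset.Icc (l - M) N,
        Fn.star T (B.coeff i) (Fn.dt T 1 (shiftCoeff i C l)) =
      ∑ i ∈ Finset.Icc (l - M - 1) N,
        Fn.star T (B.coeff i) (Fn.dt T 1 (shiftCoeff i C l)) := by
      refine Finset.sum_subset (Finset.Icc_subset_Icc (by omega) le_rfl) fun i hi hn => ?_
      simp only [Finset.mem_Icc] at hi hn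
      rw [shiftCoeff_eq_zero hM (by omega), Fn.dt_zero, Fn.star_zero]
    rw [← h1, h2]
  simp only [shift_one_coeff, Fn.add_star, Finset.sum_add_distrib] at hd ⊢
  rw [hd, hs, hext]
  simp only [shiftCoeff_succ, Fn.star_add, Finset.sum_add_distrib]
  abel

theorem shift_mul (i : ℤ) (B C : PDO T) : (B * C).shift i = B.shift i * C := by
  induction i using Int.induction_on with
  | zero => simp only [shift_zero]
  | succ i ih => rw [shift_succ, ih, shift_one_mul, shift_succ]
  | pred i ih =>
    -- For negative exponents both sides are compared after multiplication by ∂.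
    apply shift_one_injective
    rw [shift_one_mul, ← shift_succ, ← shift_succ, sub_add_cancel, ih]

/-- With `shift_mul` and associativity of ⋆, both sides are sums of a_i ⋆ (∂^i B)_j ⋆ (∂^j C)_l. The
bounds are chosen so that one rectangle of pairs (i, j) serves both orders of summation. -/
theorem mul_assoc' (A B C : PDO T) : A * B * C = A * (B * C) := by
  obtain ⟨N, hN⟩ : ∃ N, A.OrderLE N := A.bdd
  obtain ⟨M, hM⟩ : ∃ M, B.OrderLE M := B.bdd
  obtain ⟨K, hK⟩ : ∃ K, C.OrderLE K := C.bdd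
  refine PDO.ext (funext fun l => ?_)
  rw [mul_coeff_eq_sum (hN.mul hM) hK (a := l - K) (b := N + M) le_rfl le_rfl,
    mul_coeff_eq_sum hN (hM.mul hK) (a := l - K - M) (b := N) (by omega) le_rfl]
  have hl : ∀ j ∈ Finset.Icc (l - K) (N + M),
      Fn.star T ((A * B).coeff j) (shiftCoeff j C l) =
      ∑ i ∈ Finset.Icc (l - K - M) N,
        Fn.star T (A.coeff i) (Fn.star T (shiftCoeff i B j) (shiftCoeff j C l)) := by
    intro j hj
    rw [Finset.mem_Icc] at hj
    rw [mul_coeff_eq_sum hN hM (a := l - K - M) (b := N) (by omega) le_rfl, sum_star]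
    simp only [Fn.star_assoc]
  have hr : ∀ i ∈ Finset.Icc (l - K - M) N,
      Fn.star T (A.coeff i) (shiftCoeff i (B * C) l) =
      ∑ j ∈ Finset.Icc (l - K) (N + M),
        Fn.star T (A.coeff i) (Fn.star T (shiftCoeff i B j) (shiftCoeff j C l)) := by
    intro i hi
    rw [Finset.mem_Icc] at hi
    have h := congrFun (congrArg PDO.coeff (shift_mul i B C)) l
    rw [mul_coeff_eq_sum (hM.shift i) hK (a := l - K) (b := N + M) (by omega) (by omega)] at h
    change shiftCoeff i (B * C) l = _ at h
    rw [h, star_sum]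
    rfl
  rw [Finset.sum_congr rfl hl, Finset.sum_congr rfl hr, Finset.sum_comm]

theorem mul_del_coeff (A : PDO T) (n : ℕ) (l : ℤ) : (A * del T n).coeff l = A.coeff (l - n) := by
  obtain ⟨N, hN⟩ : ∃ N, A.OrderLE N := A.bdd
  rw [mul_coeff_eq_sum hN (del_orderLE n) (a := l - n) (b := max N (l - n)) le_rfl
      (le_max_left _ _), Finset.sum_eq_single (l - n)]
  · rw [shiftCoeff_del, if_pos (by omega), Fn.star_one]
  · intro i _ hi
    rw [shiftCoeff_del, if_neg (by omega), Fn.star_zero]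
  · simp

theorem one_mul' (A : PDO T) : 1 * A = A := by
  obtain ⟨N, hN⟩ : ∃ N, A.OrderLE N := A.bdd
  refine PDO.ext (funext fun l => ?_)
  rw [mul_coeff_eq_sum one_orderLE hN (a := min 0 (l - N)) (b := 0) (min_le_right _ _) le_rfl,
    Finset.sum_eq_single 0]
  · rw [shiftCoeff_zero_left, one_coeff, if_pos rfl, Fn.one_star]
  · intro i _ hi
    rw [one_coeff, if_neg hi, Fn.zero_star]
  · simp

theorem mul_one' (A : PDO T) : A * 1 = A :=
  PDO.ext (funext fun l => (mul_del_coeff A 0 l).trans (by simp))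

theorem add_mul' (A B C : PDO T) : (A + B) * C = A * C + B * C := by
  obtain ⟨N, hN⟩ : ∃ N, A.OrderLE N := A.bdd
  obtain ⟨M, hM⟩ : ∃ M, B.OrderLE M := B.bdd
  obtain ⟨K, hK⟩ : ∃ K, C.OrderLE K := C.bdd
  have h1 := hN.mono (le_max_left N M)
  have h2 := hM.mono (le_max_right N M)
  refine PDO.ext (funext fun l => ?_)
  rw [add_coeff, Pi.add_apply, mul_coeff_eq_sum h1 hK le_rfl le_rfl,
    mul_coeff_eq_sum h2 hK le_rfl le_rfl, mul_coeff_eq_sum (h1.add h2) hK le_rfl le_rfl,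
    ← Finset.sum_add_distrib]
  exact Finset.sum_congr rfl fun i _ => Fn.add_star _ _ _

theorem mul_add' (A B C : PDO T) : A * (B + C) = A * B + A * C := by
  obtain ⟨N, hN⟩ : ∃ N, A.OrderLE N := A.bdd
  obtain ⟨M, hM⟩ : ∃ M, B.OrderLE M := B.bdd
  obtain ⟨K, hK⟩ : ∃ K, C.OrderLE K := C.bdd
  have h1 := hM.mono (le_max_left M K)
  have h2 := hK.mono (le_max_right M K)
  refine PDO.ext (funext fun l => ?_)
  rw [add_coeff, Pi.add_apply, mul_coeff_eq_sum hN h1 le_rfl le_rfl,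
    mul_coeff_eq_sum hN h2 le_rfl le_rfl, mul_coeff_eq_sum hN (h1.add h2) le_rfl le_rfl,
    ← Finset.sum_add_distrib]
  exact Finset.sum_congr rfl fun i _ => by rw [shiftCoeff_add, Fn.star_add]

instance : Ring (PDO T) where
  __ := (inferInstance : AddCommGroup (PDO T))
  mul_assoc := mul_assoc'
  one_mul := one_mul'
  mul_one := mul_one'
  left_distrib := mul_add'
  right_distrib := add_mul'
  zero_mul A := by simpa using add_mul' 0 0 A
  mul_zero A := by simpa using mul_add' A 0 0
  npow n A := A ^ n
  npow_zero _ := rfl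
  npow_succ _ _ := rfl

theorem smul_coeff (c : ℚ) (A : PDO T) (j : ℤ) : (c • A).coeff j = c • A.coeff j := rfl

instance : Module ℚ (PDO T) where
  one_smul _ := PDO.ext (funext fun _ => one_smul _ _)
  mul_smul _ _ _ := PDO.ext (funext fun _ => mul_smul _ _ _)
  smul_zero _ := PDO.ext (funext fun _ => smul_zero _)
  smul_add _ _ _ := PDO.ext (funext fun _ => smul_add _ _ _)
  add_smul _ _ _ := PDO.ext (funext fun _ => add_smul _ _ _)
  zero_smul _ := PDO.ext (funext fun _ => zero_smul _ _)

theorem OrderLE.smul {A : PDO T} {N : ℤ} (hA : A.OrderLE N) (c : ℚ) : (c • A).OrderLE N :=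
  fun j hj => by rw [smul_coeff, hA j hj, smul_zero]

instance : Algebra ℚ (PDO T) := Algebra.ofModule
  (fun c A B => by
    have := map_rat_smul (AddMonoidHom.mulRight B) c A
    simpa using this)
  (fun c A B => by
    have := map_rat_smul (AddMonoidHom.mulLeft A) c B
    simpa using this)

theorem dt_mul (n : ℕ+) (A B : PDO T) : (A * B).dt n = A.dt n * B + A * B.dt n := by
  obtain ⟨N, hN⟩ : ∃ N, A.OrderLE N := A.bdd
  obtain ⟨M, hM⟩ : ∃ M, B.OrderLE M := B.bdd
  refine PDO.ext (funext fun l => ?_)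
  rw [add_coeff, Pi.add_apply, mul_coeff_eq_sum (hN.dt n) hM le_rfl le_rfl,
    mul_coeff_eq_sum hN (hM.dt n) le_rfl le_rfl, ← Finset.sum_add_distrib]
  change Fn.dt T n ((A * B).coeff l) = _
  rw [mul_coeff_eq_sum hN hM le_rfl le_rfl]
  rw [Fn.dt_sum]
  refine Finset.sum_congr rfl fun i _ => ?_
  refine (Fn.dt_star _ _ _).trans ?_
  rw [dt_shiftCoeff]
  rfl

/-- The deformed Leibniz rule passes from coefficients to operators because ∂_t and ∂_θ commute with
B ↦ ∂^i B. The correction disappears when one factor is independent of the times, as for ∂^n. -/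
theorem dtheta_mul (m n : ℕ+) (A B : PDO T) :
    (A * B).dtheta m n = A.dtheta m n * B + A * B.dtheta m n +
      (1 / 2 : ℚ) • (A.dt m * B.dt n - A.dt n * B.dt m) := by
  obtain ⟨N, hN⟩ : ∃ N, A.OrderLE N := A.bdd
  obtain ⟨M, hM⟩ : ∃ M, B.OrderLE M := B.bdd
  refine PDO.ext (funext fun l => ?_)
  have h : ∀ {A' B' : PDO T}, A'.OrderLE N → B'.OrderLE M → (A' * B').coeff l =
      ∑ i ∈ Finset.Icc (l - M) N, Fn.star T (A'.coeff i) (shiftCoeff i B' l) :=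
    fun hA hB => mul_coeff_eq_sum hA hB le_rfl le_rfl
  change Fn.dtheta m n ((A * B).coeff l) = (A.dtheta m n * B).coeff l +
    (A * B.dtheta m n).coeff l +
      (1 / 2 : ℚ) • ((A.dt m * B.dt n).coeff l - (A.dt n * B.dt m).coeff l)
  rw [h hN hM, h (hN.dtheta m n) hM, h hN (hM.dtheta m n), h (hN.dt m) (hM.dt n),
    h (hN.dt n) (hM.dt m), ← Finset.sum_sub_distrib, Finset.smul_sum, ← Finset.sum_add_distrib,
    ← Finset.sum_add_distrib]
  rw [Fn.dtheta_sum]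
  refine Finset.sum_congr rfl fun i _ => ?_
  have e := Fn.dtheta_star (T := T) m n (A.coeff i) (shiftCoeff i B l)
  rw [dt_shiftCoeff, dt_shiftCoeff, dtheta_shiftCoeff] at e
  exact e

theorem del_mul_del (m n : ℕ) : del T m * del T n = del T (m + n) := by
  refine PDO.ext (funext fun l => (mul_del_coeff _ _ _).trans ?_)
  have : l - n = m ↔ l = (m + n : ℕ) := by push_cast; omega
  simp only [del, this]

theorem del_one_mul (A : PDO T) : del T 1 * A = A * del T 1 + A.dt 1 := by
  have h : del T 1 = (1 : PDO T).shift 1 := by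
    refine PDO.ext (funext fun l => ?_)
    exact (shiftCoeff_del 1 0 l).trans (by simp [del]) |>.symm
  rw [h, ← shift_one_mul, one_mul, ← h]
  refine PDO.ext (funext fun l => ?_)
  rw [shift_one_coeff, add_coeff, Pi.add_apply, mul_del_coeff]
  rfl

/-- From ∂A = A∂ + A_x. Independence of x becomes an algebraic condition that can be conjugated by
X. -/
theorem xIndependent_iff_commute (A : PDO T) : A.XIndependent ↔ Commute (del T 1) A := by
  rw [XIndependent, Commute, SemiconjBy, del_one_mul, add_eq_left]

theorem del_one_pow (n : ℕ) : del T 1 ^ n = del T n := by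
  induction n with
  | zero => rfl
  | succ n ih => rw [pow_succ, ih, del_mul_del]

theorem XIndependent.commute_del {A : PDO T} (h : A.XIndependent) (n : ℕ) :
    Commute (del T n) A := by
  rw [← del_one_pow]
  exact ((xIndependent_iff_commute A).mp h).pow_left n

/-- `A` has no negative powers of `∂`. -/
def IsDifferential (A : PDO T) : Prop := ∀ j < 0, A.coeff j = 0

theorem IsDifferential.mul {A B : PDO T} (hA : A.IsDifferential) (hB : B.IsDifferential) :
    (A * B).IsDifferential := by
  intro l hl
  obtain ⟨N, hN⟩ : ∃ N, A.OrderLE N := A.bdd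
  obtain ⟨M, hM⟩ : ∃ M, B.OrderLE M := B.bdd
  rw [mul_coeff_eq_sum hN hM le_rfl le_rfl]
  refine Finset.sum_eq_zero fun i _ => ?_
  by_cases hi : i < 0
  · rw [hA i hi, Fn.zero_star]
  · lift i to ℕ using not_lt.mp hi
    have : shiftCoeff i B l = 0 := by
      refine finsum_eq_zero_of_forall_eq_zero fun k => ?_
      by_cases hk : l - i + k < 0
      · rw [hB _ hk, Fn.dt_iterate_zero, smul_zero]
      -- As l < 0 ≤ l - i + k, necessarily k > i, and the binomial coefficient of the natural number
      -- i vanishes.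
      · rw [Ring.choose_natCast, Nat.choose_eq_zero_of_lt (by omega), Nat.cast_zero, zero_smul]
    rw [this, Fn.star_zero]

end PDO

/-! ### Orders, differential operators, inverses and horizontal sections -/

namespace PDO

section Basic

variable {R : Type*} [Ring R] {T : Times R}

theorem eq_zero_of_orderLE {A : PDO T} (h : ∀ k : ℕ, A.OrderLE (-(k + 1))) : A = 0 :=
  PDO.ext (funext fun j => h (-j).toNat j (by omega))

theorem IsDifferential.eq_zero {A : PDO T} (h : A.IsDifferential) (h' : A.OrderLE (-1)) :
    A = 0 :=
  PDO.ext (funext fun j => by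
    by_cases hj : j < 0
    · exact h j hj
    · exact h' j (by omega))

theorem IsDifferential.sub {A B : PDO T} (hA : A.IsDifferential) (hB : B.IsDifferential) :
    (A - B).IsDifferential := fun j hj => by simp [hA j hj, hB j hj]

theorem IsDifferential.dt {A : PDO T} (hA : A.IsDifferential) (n : ℕ+) :
    (A.dt n).IsDifferential := fun j hj => by simp [PDO.dt, hA j hj]

theorem IsDifferential.dtheta {A : PDO T} (hA : A.IsDifferential) (m n : ℕ+) :
    (A.dtheta m n).IsDifferential := fun j hj => by simp [PDO.dtheta, hA j hj]

theorem nonnegPart_isDifferential (A : PDO T) : A.nonnegPart.IsDifferential :=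
  fun _ hj => if_neg (not_le.mpr hj)

theorem negPart_orderLE (A : PDO T) : A.negPart.OrderLE (-1) :=
  fun _ hj => if_neg (by omega)

theorem del_isDifferential (n : ℕ) : (del T n).IsDifferential :=
  fun _ hj => if_neg (by omega)

theorem nonnegPart_add_negPart (A : PDO T) : A.nonnegPart + A.negPart = A := by
  refine PDO.ext (funext fun j => ?_)
  rw [add_coeff, Pi.add_apply]
  by_cases hj : j < 0
  · simp [nonnegPart, negPart, hj, not_le.mpr hj]
  · simp [nonnegPart, negPart, hj, not_lt.mp hj]

/-- The decomposition into non-negative and negative powers of `∂` is unique. -/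
theorem negPart_eq {A B C : PDO T} (h : A = B + C) (hB : B.IsDifferential)
    (hC : C.OrderLE (-1)) : A.negPart = C := by
  have h1 := nonnegPart_add_negPart A
  have h2 : B - A.nonnegPart = A.negPart - C := by
    rw [sub_eq_sub_iff_add_eq_add, ← h, add_comm, h1]
  have h3 : A.negPart - C = 0 := IsDifferential.eq_zero
    (h2 ▸ hB.sub A.nonnegPart_isDifferential) (A.negPart_orderLE.sub hC)
  exact sub_eq_zero.mp h3

theorem isMonic_iff {A : PDO T} : A.IsMonic ↔ (A - 1).OrderLE (-1) := by
  constructor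
  · rintro ⟨h0, h⟩ j hj
    rw [sub_coeff, Pi.sub_apply, one_coeff, sub_eq_zero]
    rcases (by omega : j = 0 ∨ 0 < j) with rfl | hj
    · simpa using h0
    · rw [h j hj, if_neg hj.ne']
  · intro h
    have h' : ∀ j, -1 < j → A.coeff j = if j = 0 then 1 else 0 := fun j hj => by
      have := h j hj
      rwa [sub_coeff, Pi.sub_apply, one_coeff, sub_eq_zero] at this
    exact ⟨by simpa using h' 0 (by omega), fun j hj => by
      rw [h' j (by omega), if_neg hj.ne']⟩

theorem IsMonic.orderLE {A : PDO T} (h : A.IsMonic) : A.OrderLE 0 := h.2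

theorem dt_one (n : ℕ+) : (1 : PDO T).dt n = 0 := dt_del n 0

theorem dtheta_one (m n : ℕ+) : (1 : PDO T).dtheta m n = 0 := dtheta_del m n 0

theorem IsMonic.dt_orderLE {A : PDO T} (h : A.IsMonic) (n : ℕ+) : (A.dt n).OrderLE (-1) := by
  have h1 := (isMonic_iff.mp h).dt n
  have h2 := dt_add n (A - 1) 1
  rw [sub_add_cancel, dt_one, add_zero] at h2
  rwa [h2]

theorem IsMonic.dtheta_orderLE {A : PDO T} (h : A.IsMonic) (m n : ℕ+) :
    (A.dtheta m n).OrderLE (-1) := by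
  have h1 := (isMonic_iff.mp h).dtheta m n
  have h2 := dtheta_add m n (A - 1) 1
  rw [sub_add_cancel, dtheta_one, add_zero] at h2
  rwa [h2]

/-- Sequences whose increments have orders tending to `-∞` converge. -/
theorem exists_limit (B : ℕ → PDO T) (h : ∀ k : ℕ, (B (k + 1) - B k).OrderLE (-(k + 1))) :
    ∃ C : PDO T, (∀ k : ℕ, (C - B k).OrderLE (-(k + 1))) ∧ ∀ j, ∃ k, C.coeff j = (B k).coeff j := by
  have hst : ∀ j : ℤ, ∀ k, (-j).toNat ≤ k → (B k).coeff j = (B (-j).toNat).coeff j := by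
    intro j k hk
    induction k, hk using Nat.le_induction with
    | base => rfl
    | succ k hk ih =>
      have := h k j (by omega)
      rw [sub_coeff, Pi.sub_apply, sub_eq_zero] at this
      rw [this, ih]
  obtain ⟨N, hN⟩ := (B 0).bdd
  refine ⟨⟨fun j => (B (-j).toNat).coeff j, max N 0, fun j hj => ?_⟩, fun k j hj => ?_,
    fun j => ⟨_, rfl⟩⟩
  · rw [Int.toNat_eq_zero.mpr (by omega), hN j (by omega)]
  · rw [sub_coeff, Pi.sub_apply, hst j k (by omega), sub_self]

/-- The operator `c ∂^j`. -/
def monomial (j : ℤ) (c : Fn R) : PDO T :=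
  ⟨fun i => if i = j then c else 0, j, fun _ hi => if_neg hi.ne'⟩

theorem monomial_orderLE (j : ℤ) (c : Fn R) : (monomial j c : PDO T).OrderLE j :=
  fun _ hi => if_neg hi.ne'

theorem isDifferential_one : (1 : PDO T).IsDifferential := del_isDifferential 0

theorem TIndependent.xIndependent {A : PDO T} (hA : A.TIndependent) : A.XIndependent := hA 1

theorem negPart_neg (A : PDO T) : (-A).negPart = -A.negPart :=
  PDO.ext (funext fun j => by by_cases h : j < 0 <;> simp [negPart, h])

end Basic

variable {R : Type*} [Ring R] {T : Times R} [Algebra ℚ R]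

theorem IsMonic.mul {A B : PDO T} (hA : A.IsMonic) (hB : B.IsMonic) : (A * B).IsMonic := by
  rw [isMonic_iff] at *
  have : A * B - 1 = (A - 1) * (B - 1) + (A - 1) + (B - 1) := by noncomm_ring
  rw [this]
  exact (((hA.mul hB).mono (by omega)).add hA).add hB

theorem IsMonic.exists_right_inv {A : PDO T} (hA : A.IsMonic) :
    ∃ B : PDO T, B.IsMonic ∧ A * B = 1 := by
  have hA' := isMonic_iff.mp hA
  -- The iteration B ↦ B - (AB - 1) replaces the error AB - 1 by -(A - 1)(AB - 1), whose order is
  -- lower by at least one.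
  let B : ℕ → PDO T := fun k => Nat.rec 1 (fun _ B => B - (A * B - 1)) k
  have hB : ∀ k : ℕ, (A * B k - 1).OrderLE (-(k + 1)) := by
    intro k
    induction k with
    | zero => simpa [B] using hA'
    | succ k ih =>
      have : A * B (k + 1) - 1 = -((A - 1) * (A * B k - 1)) := by
        change A * (B k - (A * B k - 1)) - 1 = _
        noncomm_ring
      rw [this]
      exact (hA'.mul ih).neg.mono (by push_cast; omega)
  obtain ⟨C, hC, -⟩ := exists_limit B fun k => by
    have : B (k + 1) - B k = -(A * B k - 1) := by
      change B k - (A * B k - 1) - B k = _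
      abel
    rw [this]
    exact (hB k).neg
  refine ⟨C, isMonic_iff.mpr (by simpa [B] using hC 0), sub_eq_zero.mp ?_⟩
  refine eq_zero_of_orderLE fun k => ?_
  have : A * C - 1 = A * (C - B k) + (A * B k - 1) := by noncomm_ring
  rw [this]
  exact ((hA.orderLE.mul (hC k)).mono (by omega)).add (hB k)

theorem IsMonic.exists_inv {A : PDO T} (hA : A.IsMonic) :
    ∃ B : PDO T, B.IsMonic ∧ A * B = 1 ∧ B * A = 1 := by
  obtain ⟨B, hB, h⟩ := hA.exists_right_inv
  obtain ⟨C, -, h'⟩ := hB.exists_right_inv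
  have : A = C := by rw [← mul_one A, ← h', ← mul_assoc, h, one_mul]
  exact ⟨B, hB, h, this ▸ h'⟩

/-- Flat connections `∇_s = δ_s + G_s` with coefficients `G_s` of negative order have a horizontal
section `C = 1 + ∑_{i ≥ 1} c_i ∂^{-i}` with coefficients in a group `Q` of functions for which the
Poincaré lemma holds. -/
theorem exists_horizontal {ι : Type*} (d : ι → Fn R →+ Fn R) (δ : ι → PDO T → PDO T)
    (hδ : ∀ s A j, (δ s A).coeff j = d s (A.coeff j)) (hd : ∀ s, d s 1 = 0)
    (Q : AddSubgroup (Fn R)) (h1 : 1 ∈ Q)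
    (poincare : ∀ h : ι → Fn R, (∀ s, h s ∈ Q) → (∀ s r, d s (h r) = d r (h s)) →
      ∃ c ∈ Q, ∀ s, d s c = h s)
    (G : ι → PDO T) (hG : ∀ s, (G s).OrderLE (-1))
    (hQ : ∀ s C, (∀ j, C.coeff j ∈ Q) → ∀ j, (δ s C + G s * C).coeff j ∈ Q)
    (flat : ∀ s r C, (∀ j, C.coeff j ∈ Q) →
      δ s (δ r C + G r * C) + G s * (δ r C + G r * C) =
        δ r (δ s C + G s * C) + G r * (δ s C + G s * C)) :
    ∃ C : PDO T, C.IsMonic ∧ (∀ j, C.coeff j ∈ Q) ∧ ∀ s, δ s C = -(G s * C) := by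
  have hδ_add : ∀ s A B, δ s (A + B) = δ s A + δ s B := fun s A B =>
    PDO.ext (funext fun j => by simp [hδ])
  have hδ_order : ∀ s (A : PDO T) N, A.OrderLE N → (δ s A).OrderLE N := fun s A N h j hj => by
    rw [hδ, h j hj, map_zero]
  -- Approximate solutions: monic, with coefficients in Q, and horizontal up to an error of order at
  -- most -(k + 1).
  let P : ℕ → PDO T → Prop := fun k C => (C - 1).OrderLE (-1) ∧ (∀ j, C.coeff j ∈ Q) ∧
    ∀ s, (δ s C + G s * C).OrderLE (-(k + 1))
  have base : P 0 1 := by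
    refine ⟨by rw [sub_self]; exact fun _ _ => rfl, fun j => ?_, fun s => ?_⟩
    · rw [one_coeff]
      split_ifs
      exacts [h1, Q.zero_mem]
    · have : δ s 1 = 0 := PDO.ext (funext fun j => by
        rw [hδ, one_coeff]
        split_ifs
        · exact hd s
        · exact map_zero _)
      rw [this, zero_add, mul_one]
      simpa using hG s
  have step : ∀ k C, P k C → ∃ C', P (k + 1) C' ∧ (C' - C).OrderLE (-(k + 1)) := by
    rintro k C ⟨hC1, hCQ, hC⟩
    -- The correction c ∂^{-(k+1)} has to cancel the leading coefficient of the error. Its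
    -- integrability is flatness read at ∂^{-(k+1)}: the products of G with the errors have lower
    -- order and drop out.
    obtain ⟨c, hcQ, hc⟩ := poincare (fun s => -(δ s C + G s * C).coeff (-(k + 1)))
      (fun s => Q.neg_mem (hQ s C hCQ _)) fun s r => by
        have e := congrFun (congrArg PDO.coeff (flat s r C hCQ)) (-(k + 1))
        have z : ∀ s r, (G s * (δ r C + G r * C)).coeff (-(k + 1)) = 0 := fun s r =>
          (hG s).mul (hC r) _ (by omega)
        rw [add_coeff, add_coeff, Pi.add_apply, Pi.add_apply, z, z, add_zero, add_zero, hδ,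
          hδ] at e
        rw [map_neg, map_neg, e]
    have hm := monomial_orderLE (T := T) (-(k + 1)) c
    refine ⟨C + monomial (-(k + 1)) c, ⟨?_, fun j => ?_, fun s => ?_⟩, ?_⟩
    · rw [add_sub_right_comm]
      exact hC1.add (hm.mono (by omega))
    · refine Q.add_mem (hCQ j) ?_
      change (if j = -(k + 1) then c else 0 : Fn R) ∈ Q
      split_ifs
      exacts [hcQ, Q.zero_mem]
    · have e : δ s (C + monomial (-(k + 1)) c) + G s * (C + monomial (-(k + 1)) c) =
          ((δ s C + G s * C) + δ s (monomial (-(k + 1)) c)) + G s * monomial (-(k + 1)) c := by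
        rw [hδ_add, mul_add]
        abel
      rw [e]
      -- G times the correction has order at most -(k + 2), so only the derivative of c matters at
      -- ∂^{-(k+1)}.
      refine OrderLE.add (fun j hj => ?_) (((hG s).mul hm).mono (by push_cast; omega))
      rw [add_coeff, Pi.add_apply]
      by_cases hj' : j = -(k + 1)
      · have : (monomial (-(k + 1)) c : PDO T).coeff j = c := if_pos hj'
        rw [hδ s (monomial _ c), this, hc, hj', add_neg_cancel]
      · push_cast at hj
        rw [hC s j (by omega), hδ_order s _ _ hm j (by omega), add_zero]
    · rwa [add_sub_cancel_left]
  choose! next hnext hdiff using step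
  let B : ℕ → PDO T := fun k => Nat.rec 1 (fun k C => next k C) k
  have hB : ∀ k, P k (B k) := by
    intro k
    induction k with
    | zero => exact base
    | succ k ih => exact hnext k _ ih
  obtain ⟨C, hC, hCB⟩ := exists_limit B fun k => hdiff k (B k) (hB k)
  refine ⟨C, isMonic_iff.mpr (by simpa [B] using hC 0), fun j => ?_, fun s => ?_⟩
  · obtain ⟨k, hk⟩ := hCB j
    exact hk ▸ (hB k).2.1 j
  · refine eq_neg_of_add_eq_zero_left (eq_zero_of_orderLE fun k => ?_)
    have e : δ s C + G s * C =
        (δ s (C - B k) + G s * (C - B k)) + (δ s (B k) + G s * B k) := by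
      have := hδ_add s (C - B k) (B k)
      rw [sub_add_cancel] at this
      rw [this, mul_sub]
      abel
    rw [e]
    exact ((hδ_order s _ _ (hC k)).add (((hG s).mul (hC k)).mono (by omega))).add ((hB k).2.2 s)

end PDO

namespace PDO

variable {R : Type*} [Ring R] {T : Times R} [Algebra ℚ R]

theorem dt_sub (n : ℕ+) (A B : PDO T) : (A - B).dt n = A.dt n - B.dt n := by
  rw [eq_sub_iff_add_eq, ← dt_add, sub_add_cancel]

theorem dtheta_sub (m n : ℕ+) (A B : PDO T) :
    (A - B).dtheta m n = A.dtheta m n - B.dtheta m n := by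
  rw [eq_sub_iff_add_eq, ← dtheta_add, sub_add_cancel]

theorem dt_smul (n : ℕ+) (c : ℚ) (A : PDO T) : (c • A).dt n = c • A.dt n :=
  map_rat_smul (AddMonoidHom.mk' (dt n : PDO T → PDO T) (dt_add n)) c A

theorem dtheta_smul (m n : ℕ+) (c : ℚ) (A : PDO T) : (c • A).dtheta m n = c • A.dtheta m n :=
  map_rat_smul (AddMonoidHom.mk' (dtheta m n : PDO T → PDO T) (dtheta_add m n)) c A

theorem dtheta_del_mul (k l : ℕ+) (n : ℕ) (A : PDO T) :
    (del T n * A).dtheta k l = del T n * A.dtheta k l := by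
  simp [dtheta_mul]

theorem dt_mul_del (r : ℕ+) (n : ℕ) (A : PDO T) : (A * del T n).dt r = A.dt r * del T n := by
  rw [dt_mul, dt_del, mul_zero, add_zero]

theorem dtheta_mul_del (k l : ℕ+) (n : ℕ) (A : PDO T) :
    (A * del T n).dtheta k l = A.dtheta k l * del T n := by
  simp [dtheta_mul]

theorem TIndependent.dtheta_mul {A : PDO T} (hA : A.TIndependent) (m n : ℕ+) (B : PDO T) :
    (A * B).dtheta m n = A.dtheta m n * B + A * B.dtheta m n := by
  simp [PDO.dtheta_mul, hA m, hA n]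

theorem dtheta_mul_of_tIndependent (A : PDO T) {B : PDO T} (hB : B.TIndependent) (m n : ℕ+) :
    (A * B).dtheta m n = A.dtheta m n * B + A * B.dtheta m n := by
  simp [PDO.dtheta_mul, hB m, hB n]

theorem XIndependent.mul {A B : PDO T} (hA : A.XIndependent) (hB : B.XIndependent) :
    (A * B).XIndependent := by
  rw [XIndependent] at *
  rw [dt_mul, hA, hB, zero_mul, mul_zero, add_zero]

theorem nonnegPart_eq_sub (A : PDO T) : A.nonnegPart = A - A.negPart :=
  eq_sub_of_add_eq A.nonnegPart_add_negPart

theorem IsDifferential.smul {A : PDO T} (hA : A.IsDifferential) (c : ℚ) :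
    (c • A).IsDifferential := fun j hj => by rw [smul_coeff, hA j hj, smul_zero]

theorem negPart_smul (c : ℚ) (A : PDO T) : (c • A).negPart = c • A.negPart :=
  PDO.ext (funext fun j => by
    rw [smul_coeff]
    by_cases h : j < 0 <;> simp [negPart, h, smul_coeff])

end PDO

/-! ### Dressing operators, their time defects and the operators D_n -/

namespace Dressing

open PDO

variable {R : Type*} [Ring R] [Algebra ℚ R] {T : Times R} (φ : Dressing T)

theorem inv_isMonic : φ.inv.IsMonic := by
  obtain ⟨B, hB, h, -⟩ := φ.monic.exists_inv
  rwa [← mul_one φ.inv, ← h, ← mul_assoc, φ.inv_mul, one_mul]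

theorem inv_mul_cancel_left (A : PDO T) : φ.inv * (φ.X * A) = A := by
  rw [← mul_assoc, φ.inv_mul, one_mul]

theorem mul_inv_cancel_left (A : PDO T) : φ.X * (φ.inv * A) = A := by
  rw [← mul_assoc, φ.mul_inv, one_mul]

variable {φ} in
theorem X_mul_cancel {A B : PDO T} (h : φ.X * A = φ.X * B) : A = B := by
  rw [← φ.inv_mul_cancel_left A, h, φ.inv_mul_cancel_left]

variable {φ} in
theorem mul_X_cancel {A B : PDO T} (h : A * φ.X = B * φ.X) : A = B := by
  rw [← mul_one A, ← mul_one B, ← φ.mul_inv, ← mul_assoc, h, mul_assoc]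

theorem lax_pow (n : ℕ) : φ.lax ^ n = φ.X * del T n * φ.inv := by
  induction n with
  | zero => rw [pow_zero, show del T 0 = 1 from rfl, mul_one, φ.mul_inv]
  | succ n ih =>
    rw [pow_succ, ih, lax, ← del_mul_del]
    simp only [mul_assoc, φ.inv_mul_cancel_left]

theorem lax_pow_mul (n : ℕ) : φ.lax ^ n * φ.X = φ.X * del T n := by
  rw [lax_pow, mul_assoc, φ.inv_mul, mul_one]

theorem lax_mul : φ.lax * φ.X = φ.X * del T 1 := by
  rw [← lax_pow_mul, pow_one]

variable {φ} in
-- C commutes with ∂, so conjugation by C leaves ∂ fixed. This is the gauge freedom of X for given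
-- L.
theorem lax_eq_of_commute {χ : Dressing T} {C : PDO T} (hC : C.XIndependent)
    (h : χ.X = φ.X * C) : χ.lax = φ.lax := by
  refine χ.mul_X_cancel ?_
  rw [lax_mul, h, ← mul_assoc, lax_mul, mul_assoc, mul_assoc, (hC.commute_del 1).eq]

/-- `φ.X * C` as a dressing operator. -/
theorem exists_mul {C : PDO T} (hC : C.IsMonic) : ∃ χ : Dressing T, χ.X = φ.X * C := by
  obtain ⟨B, -, h1, h2⟩ := hC.exists_inv
  exact ⟨⟨φ.X * C, B * φ.inv, φ.monic.mul hC,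
    by rw [mul_assoc, ← mul_assoc C, h1, one_mul, φ.mul_inv],
    by rw [mul_assoc, φ.inv_mul_cancel_left, h2]⟩, rfl⟩

/-- `L^{(n)}` -/
def P (n : ℕ+) : PDO T := (φ.lax ^ (n : ℕ)).nonnegPart

/-- `L̄^{(n)}` -/
def Q (n : ℕ+) : PDO T := (φ.lax ^ (n : ℕ)).negPart

theorem P_add_Q (n : ℕ+) : φ.P n + φ.Q n = φ.lax ^ (n : ℕ) := nonnegPart_add_negPart _

theorem P_isDifferential (n : ℕ+) : (φ.P n).IsDifferential := nonnegPart_isDifferential _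

theorem Q_orderLE (n : ℕ+) : (φ.Q n).OrderLE (-1) := negPart_orderLE _

theorem Q_mul_X (n : ℕ+) : φ.Q n * φ.X = φ.X * del T n - φ.P n * φ.X := by
  rw [← lax_pow_mul, ← P_add_Q]
  noncomm_ring

/-- The defect of `X_{t_n} = -L̄^{(n)} ∗ X`, as a right factor. -/
def timeDefect (n : ℕ+) : PDO T := φ.inv * (φ.X.dt n + φ.Q n * φ.X)

theorem X_dt (n : ℕ+) : φ.X.dt n = φ.X * φ.timeDefect n - φ.Q n * φ.X := by
  rw [timeDefect, mul_inv_cancel_left, add_sub_cancel_right]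

theorem timeDefect_orderLE (n : ℕ+) : (φ.timeDefect n).OrderLE (-1) := by
  have h1 := φ.monic.dt_orderLE n
  have h2 := (φ.Q_orderLE n).mul φ.monic.orderLE
  exact (φ.inv_isMonic.orderLE.mul (h1.add h2)).mono (by omega)

variable {φ} in
theorem timeDefect_eq_zero_iff {n : ℕ+} :
    φ.timeDefect n = 0 ↔ φ.X.dt n = -(φ.Q n * φ.X) := by
  constructor
  · intro h
    rw [X_dt, h, mul_zero, zero_sub]
  · intro h
    rw [timeDefect, h, neg_add_cancel, mul_zero]

theorem ncKPHierarchy_iff : φ.NcKPHierarchy ↔ ∀ n, φ.timeDefect n = 0 := by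
  simp only [timeDefect_eq_zero_iff, NcKPHierarchy, Q, lax_pow]

theorem lax_dt_mul_X (n : ℕ+) :
    φ.lax.dt n * φ.X = (φ.lax * φ.Q n - φ.Q n * φ.lax) * φ.X +
      φ.X * (φ.timeDefect n * del T 1 - del T 1 * φ.timeDefect n) := by
  have h := congrArg (dt n) φ.lax_mul
  rw [dt_mul, dt_mul_del, X_dt] at h
  rw [eq_sub_of_add_eq h]
  have h1 : ∀ A, φ.lax * (φ.X * A) = φ.X * (del T 1 * A) := fun A => by
    rw [← mul_assoc, lax_mul, mul_assoc]
  simp only [mul_sub, sub_mul, mul_assoc, h1, lax_mul]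
  abel

/-- L^n commutes with L, so its two parts have opposite commutators with L. -/
theorem comm_P_eq (n : ℕ+) : comm (φ.P n) φ.lax = φ.lax * φ.Q n - φ.Q n * φ.lax := by
  rw [PDO.comm, eq_sub_of_add_eq (φ.P_add_Q n), sub_mul, mul_sub, ← pow_succ, ← pow_succ']
  abel

variable {φ} in
-- By `lax_dt_mul_X` the two sides differ by X [F_n, ∂] X⁻¹, and X can be cancelled.
theorem lax_dt_eq_iff {n : ℕ+} :
    φ.lax.dt n = comm (φ.P n) φ.lax ↔ (φ.timeDefect n).XIndependent := by
  rw [xIndependent_iff_commute, comm_P_eq]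
  constructor
  · intro h
    have h1 := φ.lax_dt_mul_X n
    rw [h, left_eq_add] at h1
    have h2 : φ.X * (φ.timeDefect n * del T 1 - del T 1 * φ.timeDefect n) = φ.X * 0 := by
      rw [h1, mul_zero]
    exact (sub_eq_zero.mp (X_mul_cancel h2)).symm
  · intro h
    refine φ.mul_X_cancel ?_
    rw [lax_dt_mul_X, h.eq, sub_self, mul_zero, add_zero]

theorem ncKPHierarchy_lax_iff :
    φ.lax.NcKPHierarchy ↔ ∀ n, (φ.timeDefect n).XIndependent := by
  simp only [← lax_dt_eq_iff]
  rfl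

/-- `D_n f = f_{t_n} - L^{(n)} ∗ f` -/
def covT (n : ℕ+) (f : PDO T) : PDO T := f.dt n - φ.P n * f

theorem covT_isDifferential (n : ℕ+) {f : PDO T} (hf : f.IsDifferential) :
    (φ.covT n f).IsDifferential := (hf.dt n).sub ((φ.P_isDifferential n).mul hf)

/-- The dressed form of D_n: since P_n X + Q_n X = X ∂^n, conjugation by X turns P_n into ∂^n - F_n.
-/
theorem covT_X_mul (n : ℕ+) (f : PDO T) :
    φ.covT n (φ.X * f) = φ.X * (f.dt n - del T n * f + φ.timeDefect n * f) := by
  rw [covT, dt_mul, X_dt, Q_mul_X]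
  noncomm_ring

/-- A differential operator of the form `X ∗ A ∗ X⁻¹` with `A` of negative order is zero. -/
theorem eq_zero_of_isDifferential {A : PDO T} (hA : A.OrderLE (-1))
    (h : (φ.X * (A * φ.inv)).IsDifferential) : A = 0 := by
  have h0 := h.eq_zero
    ((φ.monic.orderLE.mul (hA.mul φ.inv_isMonic.orderLE)).mono (by omega))
  have h1 : φ.X * (A * φ.inv) * φ.X = φ.X * A := by
    rw [mul_assoc, mul_assoc, φ.inv_mul, mul_one]
  rw [h0, zero_mul] at h1
  exact φ.X_mul_cancel (by rw [← h1, mul_zero])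

/-- [D_m, D_n] applied to 1 = X X⁻¹ is differential, because each D preserves differential
operators, and equals X K X⁻¹ with K the curvature of F, of negative order; so K = 0. Independence
of x removes the cross terms of F with the powers of ∂. -/
theorem timeDefect_flat (h : ∀ n, (φ.timeDefect n).XIndependent) (m n : ℕ+) :
    (φ.timeDefect n).dt m + φ.timeDefect m * φ.timeDefect n =
      (φ.timeDefect m).dt n + φ.timeDefect n * φ.timeDefect m := by
  set F := φ.timeDefect with hF
  have key : φ.X * (((F n).dt m + F m * F n - ((F m).dt n + F n * F m)) * φ.inv) =
      φ.covT m (φ.covT n 1) - φ.covT n (φ.covT m 1) := by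
    have e1 := ((h n).commute_del m).eq
    have e2 := ((h m).commute_del n).eq
    have e3 : del T (m : ℕ) * del T (n : ℕ) = del T (n : ℕ) * del T (m : ℕ) := by
      rw [del_mul_del, del_mul_del, add_comm]
    rw [← φ.mul_inv, covT_X_mul, covT_X_mul, covT_X_mul, covT_X_mul, ← mul_sub]
    congr 1
    rw [← hF]
    simp only [PDO.dt_add, PDO.dt_sub, dt_mul, dt_del, mul_add, mul_sub, add_mul, sub_mul,
      zero_mul, ← mul_assoc, e1, e2, e3, dt_comm m n]
    abel
  refine sub_eq_zero.mp (φ.eq_zero_of_isDifferential ?_ ?_)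
  · have ho := φ.timeDefect_orderLE
    rw [← hF] at ho
    exact (((ho n).dt m).add (((ho m).mul (ho n)).mono (by omega))).sub
      (((ho m).dt n).add (((ho n).mul (ho m)).mono (by omega)))
  · rw [key]
    exact (φ.covT_isDifferential _ (φ.covT_isDifferential _ isDifferential_one)).sub
      (φ.covT_isDifferential _ (φ.covT_isDifferential _ isDifferential_one))

/-! ### The θ defects and the operators D_θ -/

/-- `½ (L̄^{(m)} ∗ L^n - L̄^{(n)} ∗ L^m)` -/
def Z (m n : ℕ+) : PDO T :=
  (1 / 2 : ℚ) • (φ.Q m * φ.lax ^ (n : ℕ) - φ.Q n * φ.lax ^ (m : ℕ))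

/-- Splitting L^n and L^m in Z leaves minus the operator whose non-negative part is W, plus ½[Q_m,
Q_n], which has negative order. Hence Z_{≥0} = -W. -/
theorem Z_negPart (m n : ℕ+) : (φ.Z m n).negPart = φ.Z m n + φ.lax.W m n := by
  set A := (1 / 2 : ℚ) • (φ.Q n * φ.P m - φ.Q m * φ.P n) with hA
  have hW : φ.lax.W m n = A.nonnegPart := rfl
  have hZ : φ.Z m n = -A + (1 / 2 : ℚ) • (φ.Q m * φ.Q n - φ.Q n * φ.Q m) := by
    rw [Z, hA, ← P_add_Q, ← P_add_Q, ← smul_neg, ← smul_add]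
    congr 1
    noncomm_ring
  refine negPart_eq (B := -φ.lax.W m n) (by abel) ?_ ?_
  · intro j hj
    rw [hW, neg_coeff, Pi.neg_apply, nonnegPart_isDifferential A j hj, neg_zero]
  · have hQ := fun m n => ((φ.Q_orderLE m).mul (φ.Q_orderLE n)).mono (M := -1) (by omega)
    have : φ.Z m n + φ.lax.W m n =
        (1 / 2 : ℚ) • (φ.Q m * φ.Q n - φ.Q n * φ.Q m) - A.negPart := by
      rw [hZ, hW, nonnegPart_eq_sub]
      abel
    rw [this]
    exact (((hQ m n).sub (hQ n m)).smul _).sub (negPart_orderLE _)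

/-- The defect of the deformation equation for `X`, as a right factor. -/
def defect (m n : ℕ+) : PDO T := φ.inv * (φ.X.dtheta m n - (φ.Z m n).negPart * φ.X)

theorem X_dtheta (m n : ℕ+) :
    φ.X.dtheta m n = (φ.Z m n).negPart * φ.X + φ.X * φ.defect m n := by
  rw [defect, mul_inv_cancel_left, add_sub_cancel]

theorem defect_orderLE (m n : ℕ+) : (φ.defect m n).OrderLE (-1) := by
  have h1 := φ.monic.dtheta_orderLE m n
  have h2 := (negPart_orderLE (φ.Z m n)).mul φ.monic.orderLE
  exact (φ.inv_isMonic.orderLE.mul (h1.sub h2)).mono (by omega)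

variable {φ} in
theorem deformationEqLax_iff {m n : ℕ+} : φ.DeformationEqLax m n ↔ φ.defect m n = 0 := by
  have e : (φ.Z m n).negPart * φ.X = (1 / 2 : ℚ) • ((φ.Q m * φ.lax ^ (n : ℕ)
      - φ.Q n * φ.lax ^ (m : ℕ)).negPart * φ.X) := by
    rw [Z, negPart_smul, smul_mul_assoc]
  rw [DeformationEqLax]
  change φ.X.dtheta m n = (1 / 2 : ℚ) • ((φ.Q m * φ.lax ^ (n : ℕ)
      - φ.Q n * φ.lax ^ (m : ℕ)).negPart * φ.X) ↔ _
  rw [← e]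
  constructor
  · intro h
    rw [defect, h, sub_self, mul_zero]
  · intro h
    rw [X_dtheta, h, mul_zero, add_zero]

theorem defect_swap (m n : ℕ+) : φ.defect n m = -φ.defect m n := by
  have : φ.Z n m = -φ.Z m n := by
    rw [Z, Z, ← smul_neg, neg_sub]
  rw [defect, defect, this, PDO.negPart_neg, dtheta_swap m n]
  noncomm_ring

theorem defect_self (m : ℕ+) : φ.defect m m = 0 := by
  have : φ.Z m m = 0 := by rw [Z, sub_self, smul_zero]
  have h0 : (0 : PDO T).negPart = 0 := PDO.ext (funext fun j => by simp [PDO.negPart])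
  rw [defect, this, dtheta_self, h0, zero_mul, sub_zero, mul_zero]

variable {φ}

/-- Under (2), X_{t_m} ∂^n X⁻¹ = -Q_m X ∂^n X⁻¹ = -Q_m L^n, so (4) and (5) have the same right-hand
side. -/
theorem deformationEq_iff_lax (h : φ.NcKPHierarchy) (m n : ℕ+) :
    φ.DeformationEq m n ↔ φ.DeformationEqLax m n := by
  have hX : ∀ m n : ℕ+, φ.X.dt m * del T n * φ.inv = -(φ.Q m * φ.lax ^ (n : ℕ)) := by
    intro m n
    rw [timeDefect_eq_zero_iff.mp (φ.ncKPHierarchy_iff.mp h m), lax_pow]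
    noncomm_ring
  rw [DeformationEq, DeformationEqLax, hX, hX, ← neg_sub_neg, ← smul_neg, ← neg_mul,
    ← PDO.negPart_neg]
  simp only [neg_neg, neg_sub, Q]

/-- Under the hierarchy for `X`, the deformation equation for `L` says that the defect of the
deformation equation for `X` commutes with `∂`. -/
theorem lax_deformationEq_iff (h : φ.NcKPHierarchy) (m n : ℕ+) :
    φ.lax.DeformationEq m n ↔ (φ.defect m n).XIndependent := by
  have hT := φ.ncKPHierarchy_iff.mp h
  have hL : ∀ n, φ.lax.dt n = φ.lax * φ.Q n - φ.Q n * φ.lax := fun n => by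
    refine φ.mul_X_cancel ?_
    rw [lax_dt_mul_X, hT n]
    simp
  have hX : ∀ n, φ.X.dt n = -(φ.Q n * φ.X) := fun n => timeDefect_eq_zero_iff.mp (hT n)
  -- The θ-derivative of L X = X ∂; its Moyal term involves L_t and X_t, both known from the
  -- hierarchy.
  have h0 := congrArg (dtheta m n) φ.lax_mul
  rw [dtheta_mul, dtheta_mul_del, X_dtheta, Z_negPart, hX, hX, add_assoc] at h0
  have h1 : ∀ A, φ.X * (del T 1 * A) = φ.lax * (φ.X * A) := fun A => by
    rw [← mul_assoc, ← mul_assoc, lax_mul]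
  have h2 : ∀ (k : ℕ) (A : PDO T), φ.lax ^ k * (φ.lax * A) = φ.lax * (φ.lax ^ k * A) :=
    fun k A => by rw [← mul_assoc, ← pow_succ, pow_succ', mul_assoc]
  -- The error in the equation for L is X [G, ∂] X⁻¹.
  have key : (φ.lax.dtheta m n - (comm (φ.lax.W m n) φ.lax +
      (1 / 2 : ℚ) • (φ.lax.dt n * φ.P m - φ.lax.dt m * φ.P n))) * φ.X =
      φ.X * (φ.defect m n * del T 1 - del T 1 * φ.defect m n) := by
    rw [sub_mul, eq_sub_of_add_eq h0, hL, hL, Z, PDO.comm, eq_sub_of_add_eq (φ.P_add_Q m),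
      eq_sub_of_add_eq (φ.P_add_Q n)]
    simp only [mul_add, add_mul, mul_sub, sub_mul, smul_mul_assoc, mul_smul_comm, smul_sub,
      smul_neg, mul_assoc, mul_neg, h1, h2, ← φ.lax_mul]
    abel
  rw [xIndependent_iff_commute]
  constructor
  · intro hd
    have hd' : φ.lax.dtheta m n - (comm (φ.lax.W m n) φ.lax +
      (1 / 2 : ℚ) • (φ.lax.dt n * φ.P m - φ.lax.dt m * φ.P n)) = 0 := sub_eq_zero.mpr hd
    rw [hd', zero_mul] at key
    exact (sub_eq_zero.mp (φ.X_mul_cancel (key.symm.trans (mul_zero _).symm))).symm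
  · intro hc
    rw [hc.eq, sub_self, mul_zero] at key
    exact sub_eq_zero.mp (φ.mul_X_cancel (key.trans (zero_mul _).symm))

variable (φ)

/-- `D_{θ_{m,n}} f = f_{θ_{m,n}} - W^{(m,n)} ∗ f - ½ (L^{(m)} ∗ D_n f - L^{(n)} ∗ D_m f)` -/
def covTheta (m n : ℕ+) (f : PDO T) : PDO T :=
  f.dtheta m n - φ.lax.W m n * f - (1 / 2 : ℚ) • (φ.P m * φ.covT n f - φ.P n * φ.covT m f)

theorem covTheta_isDifferential (m n : ℕ+) {f : PDO T} (hf : f.IsDifferential) :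
    (φ.covTheta m n f).IsDifferential := by
  refine ((hf.dtheta m n).sub ((nonnegPart_isDifferential _).mul hf)).sub (IsDifferential.smul ?_ _)
  exact ((φ.P_isDifferential m).mul (φ.covT_isDifferential n hf)).sub
    ((φ.P_isDifferential n).mul (φ.covT_isDifferential m hf))

variable {φ}

theorem covT_X_mul_of_hierarchy (h : φ.NcKPHierarchy) (n : ℕ+) (f : PDO T) :
    φ.covT n (φ.X * f) = φ.X * (f.dt n - del T n * f) := by
  rw [covT_X_mul, φ.ncKPHierarchy_iff.mp h n, zero_mul, add_zero]

theorem del_comm (m n : ℕ) : del T m * del T n = del T n * del T m := by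
  rw [del_mul_del, del_mul_del, add_comm]

/-- The term ½(P_m D_n - P_n D_m) in D_θ is there to absorb the Moyal term of (X f)_θ. What remains,
apart from G, is built from ∂_θ, ∂_t and left multiplications by powers of ∂, all of which commute.
-/
theorem covTheta_X_mul (h : φ.NcKPHierarchy) (m n : ℕ+) (f : PDO T) :
    φ.covTheta m n (φ.X * f) = φ.X * (f.dtheta m n -
      (1 / 2 : ℚ) • (del T m * f.dt n - del T n * f.dt m) + φ.defect m n * f) := by
  have hX : ∀ n, φ.X.dt n = φ.P n * φ.X - φ.X * del T n := fun n => by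
    rw [timeDefect_eq_zero_iff.mp (φ.ncKPHierarchy_iff.mp h n), Q_mul_X, neg_sub]
  have hZ : φ.Z m n * φ.X = (1 / 2 : ℚ) • ((φ.X * del T m - φ.P m * φ.X) * del T n -
      (φ.X * del T n - φ.P n * φ.X) * del T m) := by
    rw [Z, smul_mul_assoc, sub_mul, mul_assoc, mul_assoc, lax_pow_mul, lax_pow_mul, ← mul_assoc,
      ← mul_assoc, Q_mul_X, Q_mul_X]
  rw [covTheta, covT_X_mul_of_hierarchy h, covT_X_mul_of_hierarchy h, dtheta_mul, X_dtheta,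
    Z_negPart, add_mul (φ.Z m n), hZ, hX, hX]
  have h1 : ∀ A, del T (m : ℕ) * (del T (n : ℕ) * A) = del T (n : ℕ) * (del T (m : ℕ) * A) :=
    fun A => by rw [← mul_assoc, del_comm, mul_assoc]
  simp only [mul_add, add_mul, mul_sub, sub_mul, smul_mul_assoc, mul_smul_comm, smul_sub,
    mul_assoc, h1]
  abel

/-- If the defect of the deformation equation for `X` is independent of `x`, it is independent
of all the times. -/
theorem defect_tIndependent (h : φ.NcKPHierarchy) {m n : ℕ+}
    (hx : (φ.defect m n).XIndependent) : (φ.defect m n).TIndependent := by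
  intro r
  set F := φ.defect m n with hF
  -- [D_r, D_θ] applied to X X⁻¹: only G_{t_r} survives, since G commutes with ∂^r.
  have key : φ.X * (F.dt r * φ.inv) =
      φ.covT r (φ.covTheta m n 1) - φ.covTheta m n (φ.covT r 1) := by
    have e1 : ∀ A, del T r * (F * A) = F * (del T r * A) := fun A => by
      rw [← mul_assoc, (hx.commute_del r).eq, mul_assoc]
    have e2 : ∀ (k : ℕ) A, del T r * (del T k * A) = del T k * (del T r * A) := fun k A => by
      rw [← mul_assoc, del_comm, mul_assoc]
    rw [← φ.mul_inv, covTheta_X_mul h, covT_X_mul_of_hierarchy h, covT_X_mul_of_hierarchy h,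
      covTheta_X_mul h, ← mul_sub, ← hF]
    congr 1
    simp only [PDO.dt_add, PDO.dt_sub, PDO.dtheta_sub, PDO.dt_smul, dt_mul, dt_del,
      dtheta_del_mul, mul_add, mul_sub, smul_sub, mul_smul_comm, zero_mul, zero_add, e1, e2,
      dt_dtheta, dt_comm r m, dt_comm r n]
    abel
  refine φ.eq_zero_of_isDifferential ((φ.defect_orderLE m n).dt r) ?_
  rw [key]
  exact (φ.covT_isDifferential _ (φ.covTheta_isDifferential _ _ isDifferential_one)).sub
      (φ.covTheta_isDifferential _ _ (φ.covT_isDifferential _ isDifferential_one))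

/-- The argument of `timeDefect_flat` for two operators D_θ. Independence of all times is needed
here: it removes both the Moyal terms in (G f)_θ and the cross terms of G with ∂^m ∂_{t_n}. -/
theorem defect_flat (h : φ.NcKPHierarchy) {m n k l : ℕ+} (hx : (φ.defect m n).TIndependent)
    (hx' : (φ.defect k l).TIndependent) :
    (φ.defect k l).dtheta m n + φ.defect m n * φ.defect k l =
      (φ.defect m n).dtheta k l + φ.defect k l * φ.defect m n := by
  set F := φ.defect m n with hF
  set F' := φ.defect k l with hF'
  have key : φ.X * ((F'.dtheta m n + F * F' - (F.dtheta k l + F' * F)) * φ.inv) =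
      φ.covTheta m n (φ.covTheta k l 1) - φ.covTheta k l (φ.covTheta m n 1) := by
    have e1 : ∀ (r : ℕ) A, del T r * (F * A) = F * (del T r * A) := fun r A => by
      rw [← mul_assoc, (hx.xIndependent.commute_del r).eq, mul_assoc]
    have e1' : ∀ (r : ℕ) A, del T r * (F' * A) = F' * (del T r * A) := fun r A => by
      rw [← mul_assoc, (hx'.xIndependent.commute_del r).eq, mul_assoc]
    have e2 : ∀ (i j : ℕ) A, del T i * (del T j * A) = del T (i + j) * A := fun i j A => by
      rw [← mul_assoc, del_mul_del]
    rw [← φ.mul_inv, covTheta_X_mul h, covTheta_X_mul h, covTheta_X_mul h,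
      covTheta_X_mul h, ← mul_sub, ← hF, ← hF']
    congr 1
    simp only [PDO.dt_add, PDO.dt_sub, PDO.dtheta_sub, PDO.dtheta_add, PDO.dtheta_smul,
      PDO.dt_smul, dt_mul, dt_del, hx _, hx' _, hx.dtheta_mul, hx'.dtheta_mul,
      dtheta_del_mul, mul_add, mul_sub, add_mul, sub_mul, smul_sub, smul_add, mul_smul_comm,
      zero_mul, zero_add, e1, e1', e2, dt_dtheta, dt_comm k m, dt_comm k n, dt_comm l m,
      dt_comm l n, dtheta_comm k l m n, mul_assoc]
    rw [add_comm (k : ℕ) m, add_comm (k : ℕ) n, add_comm (l : ℕ) m, add_comm (l : ℕ) n]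
    abel
  refine sub_eq_zero.mp (φ.eq_zero_of_isDifferential ?_ ?_)
  · have ho := φ.defect_orderLE
    exact (((ho k l).dtheta m n).add (((ho m n).mul (ho k l)).mono (by omega))).sub
      (((ho m n).dtheta k l).add (((ho k l).mul (ho m n)).mono (by omega)))
  · rw [key]
    exact (φ.covTheta_isDifferential _ _ (φ.covTheta_isDifferential _ _ isDifferential_one)).sub
      (φ.covTheta_isDifferential _ _ (φ.covTheta_isDifferential _ _ isDifferential_one))

end Dressing

/-! ### Poincaré lemmas: formal power series, matrices, smooth functions -/

open Finsupp

/-- The formal Poincaré lemma: a family of formal power series (given by their coefficients)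
indexed by some of the variables and satisfying the compatibility conditions is the family of
partial derivatives of a formal power series. -/
theorem exists_formal_primitive {σ M : Type*} [AddCommGroup M] [Module ℚ M] (S : Set σ)
    (h : S → (σ →₀ ℕ) → M)
    (closed : ∀ (p q : S) γ,
      (γ p.1 + 1) • h q (γ + single p.1 1) = (γ q.1 + 1) • h p (γ + single q.1 1)) :
    ∃ c : (σ →₀ ℕ) → M, (∀ (p : S) γ, (γ p.1 + 1) • c (γ + single p.1 1) = h p γ) ∧
      ∀ γ, c γ = 0 ∨ ∃ (a : ℚ) (p : S) (δ : σ →₀ ℕ), c γ = a • h p δ := by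
  classical
  -- Where γ contains a variable p of S, the equation for p forces c γ = h_p(γ - p)/γ_p; closedness
  -- makes this independent of the chosen p. Other coefficients are unconstrained and set to zero.
  let c : (σ →₀ ℕ) → M := fun γ =>
    if e : ∃ p : S, γ p.1 ≠ 0 then
      (1 / (γ e.choose.1 : ℚ)) • h e.choose (γ - single e.choose.1 1)
    else 0
  refine ⟨c, fun p γ => ?_, fun γ => ?_⟩
  · have e : ∃ q : S, (γ + single p.1 1 : σ →₀ ℕ) q.1 ≠ 0 := ⟨p, by simp⟩
    have hc : c (γ + single p.1 1) = (1 / ((γ + single p.1 1 : σ →₀ ℕ) e.choose.1 : ℚ)) •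
      h e.choose (γ + single p.1 1 - single e.choose.1 1) := dif_pos e
    have hq := e.choose_spec
    generalize e.choose = q at hc hq
    rw [hc]
    by_cases hpq : q = p
    · subst hpq
      simp only [Finsupp.add_apply, single_eq_same, add_tsub_cancel_right]
      rw [← Nat.cast_smul_eq_nsmul ℚ, smul_smul, mul_one_div_cancel (by positivity), one_smul]
    · have hne : q.1 ≠ p.1 := fun h => hpq (Subtype.ext h)
      have hγ : γ q.1 ≠ 0 := by simpa [Finsupp.single_eq_of_ne hne] using hq
      have hle : single q.1 1 ≤ γ := by rw [Finsupp.single_le_iff]; omega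
      obtain ⟨δ, rfl⟩ : ∃ δ, γ = δ + single q.1 1 :=
        ⟨γ - single q.1 1, (tsub_add_cancel_of_le hle).symm⟩
      have hcl := closed p q δ
      simp only [Finsupp.add_apply, single_eq_same, Finsupp.single_eq_of_ne hne,
        Finsupp.single_eq_of_ne hne.symm, add_zero]
      rw [add_right_comm, add_tsub_cancel_right, smul_comm, hcl, ← Nat.cast_smul_eq_nsmul ℚ,
        smul_smul, one_div_mul_cancel (by positivity), one_smul]
  · by_cases e : ∃ p : S, γ p.1 ≠ 0
    · exact Or.inr ⟨_, _, _, dif_pos e⟩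
    · exact Or.inl (dif_neg e)

/-- The Poincaré lemma holds for functions of the times. -/
def Times.Poincare {R : Type*} [Ring R] (T : Times R) : Prop :=
  ∀ h : ℕ+ → R, (∀ m n, T.D m (h n) = T.D n (h m)) → ∃ c, ∀ n, T.D n c = h n

theorem Times.Poincare.matrix {R : Type*} [Ring R] {T : Times R} (hT : T.Poincare) (N : ℕ) :
    (T.matrix N).Poincare := by
  intro h hc
  choose c hc' using fun i j => hT (fun n => h n i j) fun m n =>
    congrFun (congrFun (hc m n) i) j
  exact ⟨Matrix.of c, fun n => Matrix.ext fun i j => hc' i j n⟩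

theorem Times.Poincare.fn {R : Type*} [Ring R] {T : Times R} (hT : T.Poincare) (h : ℕ+ → Fn R)
    (hc : ∀ m n, Fn.dt T m (h n) = Fn.dt T n (h m)) : ∃ c, ∀ n, Fn.dt T n c = h n := by
  choose c hc' using fun γ => hT (fun n => h n γ) fun m n => congrFun (hc m n) γ
  exact ⟨c, fun n => funext fun γ => hc' γ n⟩

theorem formalTimes_poincare (K : Type*) [CommRing K] [Algebra ℚ K] :
    (formalTimes K).Poincare := by
  have hD : ∀ n (f : MvPowerSeries ℕ+ K) γ, (formalTimes K).D n f γ =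
      (γ n + 1) • f (γ + single n 1) := by
    intro n f γ
    refine (MvPowerSeries.coeff_pderiv f γ).trans ?_
    rw [nsmul_eq_mul, mul_comm, Nat.cast_succ]
    rfl
  intro h hc
  obtain ⟨c, hc', -⟩ := exists_formal_primitive Set.univ (fun (p : (Set.univ : Set ℕ+)) => h p.1)
    fun p q γ => by
      have := congrFun (hc p.1 q.1) γ
      rwa [hD, hD] at this
  exact ⟨c, fun n => funext fun γ => (hD n c γ).trans (hc' ⟨n, trivial⟩ γ)⟩

/-- By the last clause each coefficient of the primitive is zero or a rational multiple of a
coefficient of the data. Independence of the times is thus inherited. -/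
theorem Fn.exists_pd_eq {R : Type*} [Ring R] [Algebra ℚ R] (S : Set Theta) (h : S → Fn R)
    (hc : ∀ p q : S, Fn.pd p.1 (h q) = Fn.pd q.1 (h p)) :
    ∃ c : Fn R, (∀ p : S, Fn.pd p.1 c = h p) ∧
      ∀ γ, c γ = 0 ∨ ∃ (a : ℚ) (p : S) (δ : Theta →₀ ℕ), c γ = a • h p δ := by
  obtain ⟨c, h1, h2⟩ := exists_formal_primitive S h fun p q γ => by
    have := congrFun (hc p q) γ
    rwa [Fn.pd_apply, Fn.pd_apply] at this
  exact ⟨c, fun p => funext fun γ => (Fn.pd_apply _ _ _).trans (h1 p γ), h2⟩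

section Smooth

variable {𝕜 : Type*} [RCLike 𝕜]

/-- The inclusion of the space of finitely many times. -/
def inclTimes (s : Finset ℕ+) : (s → ℝ) →ₗ[ℝ] TimeSpace :=
  Fintype.linearCombination ℝ fun n : s => single (n : ℕ+) (1 : ℝ)

/-- The projection to the space of finitely many times. -/
def projTimes (s : Finset ℕ+) : TimeSpace →ₗ[ℝ] (s → ℝ) :=
  LinearMap.pi fun n => Finsupp.lapply (n : ℕ+)

theorem inclTimes_apply (s : Finset ℕ+) (v : s → ℝ) :
    inclTimes s v = ∑ n : s, v n • single (n : ℕ+) (1 : ℝ) := rfl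

theorem inclTimes_single (s : Finset ℕ+) (n : s) :
    inclTimes s (Pi.single n 1) = single (n : ℕ+) (1 : ℝ) := by
  classical
  simp [inclTimes_apply, Pi.single_apply]

theorem support_inclTimes_subset (s : Finset ℕ+) (v : s → ℝ) : (inclTimes s v).support ⊆ s := by
  rw [← Finset.coe_subset, ← Finsupp.mem_supported (R := ℝ) (M := ℝ)]
  rw [inclTimes_apply]
  exact Submodule.sum_mem _ fun n _ => Submodule.smul_mem _ _
    (Finsupp.single_mem_supported ℝ _ n.2)

theorem inclTimes_projTimes {s : Finset ℕ+} {t : TimeSpace} (h : t.support ⊆ s) :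
    inclTimes s (projTimes s t) = t := by
  rw [inclTimes_apply]
  change ∑ n : s, t n • single (n : ℕ+) (1 : ℝ) = t
  rw [Finset.sum_coe_sort s fun n => t n • single n (1 : ℝ)]
  conv_rhs => rw [← Finsupp.sum_single t]
  rw [Finsupp.sum_of_support_subset t h _ fun _ _ => Finsupp.single_zero _]
  simp

theorem projTimes_inclTimes (s : Finset ℕ+) (v : s → ℝ) : projTimes s (inclTimes s v) = v := by
  classical
  ext n
  change (inclTimes s v) n = v n
  simp only [inclTimes_apply, Finsupp.coe_finsetSum, Finset.sum_apply, Finsupp.smul_apply,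
    Finsupp.single_apply, Subtype.coe_inj]
  simp

/-- The one-form `∑_n h_n dt_n` at `t`. -/
def oneForm (h : ℕ+ → TimeSpace → 𝕜) (t : TimeSpace) : TimeSpace →ₗ[ℝ] 𝕜 :=
  Finsupp.linearCombination ℝ fun n => h n t

theorem oneForm_single (h : ℕ+ → TimeSpace → 𝕜) (t : TimeSpace) (n : ℕ+) :
    oneForm h t (single n 1) = h n t := by
  simp [oneForm]

/-- The one-form `∑_n h_n dt_n` restricted to finitely many times. -/
def restrictedForm (h : ℕ+ → TimeSpace → 𝕜) (s : Finset ℕ+) (v : s → ℝ) : (s → ℝ) →L[ℝ] 𝕜 :=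
  ∑ n : s, ContinuousLinearMap.smulRightL ℝ (s → ℝ) 𝕜 (ContinuousLinearMap.proj n)
    (h n (inclTimes s v))

theorem restrictedForm_apply (h : ℕ+ → TimeSpace → 𝕜) (s : Finset ℕ+) (v w : s → ℝ) :
    restrictedForm h s v w = oneForm h (inclTimes s v) (inclTimes s w) := by
  rw [inclTimes_apply s w, map_sum]
  simp only [map_smul, oneForm_single]
  simp [restrictedForm]

theorem contDiff_restrictedForm {h : ℕ+ → TimeSpace → 𝕜} (hs : ∀ n, IsSmooth (h n))
    (s : Finset ℕ+) : ContDiff ℝ (⊤ : ℕ∞) (restrictedForm h s) := by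
  unfold restrictedForm
  refine ContDiff.sum fun n _ => ?_
  exact (ContinuousLinearMap.contDiff _).comp (hs n (s → ℝ) (inclTimes s))

theorem fderiv_comp_inclTimes {f : TimeSpace → 𝕜} (hf : IsSmooth f) (s : Finset ℕ+)
    (v w : s → ℝ) : fderiv ℝ (fun v => f (inclTimes s v)) v w =
      ∑ n : s, w n • partialT n f (inclTimes s v) := by
  classical
  conv_lhs => rw [pi_eq_sum_univ' w, map_sum]
  refine Finset.sum_congr rfl fun n _ => ?_
  rw [map_smul]
  congr 1
  rw [partialT_eq_fderiv hf (inclTimes s) (Pi.single n 1) n (inclTimes_single s n)]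

/-- Expanded in coordinates, the derivative is the bilinear form with entries ∂_m h_n, symmetric by
closedness. -/
theorem fderiv_restrictedForm_symm {h : ℕ+ → TimeSpace → 𝕜} (hs : ∀ n, IsSmooth (h n))
    (closed : ∀ m n, partialT m (h n) = partialT n (h m)) (s : Finset ℕ+) (v x y : s → ℝ) :
    fderiv ℝ (restrictedForm h s) v x y = fderiv ℝ (restrictedForm h s) v y x := by
  have hd : HasFDerivAt (restrictedForm h s)
      (∑ n : s, (ContinuousLinearMap.smulRightL ℝ (s → ℝ) 𝕜 (ContinuousLinearMap.proj n)).comp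
        (fderiv ℝ (fun v => h n (inclTimes s v)) v)) v := by
    unfold restrictedForm
    refine HasFDerivAt.fun_sum fun n _ => ?_
    exact (ContinuousLinearMap.hasFDerivAt _).comp v
      (((hs n (s → ℝ) (inclTimes s)).differentiable (by simp) v).hasFDerivAt)
  have hxy : ∀ x y : s → ℝ, fderiv ℝ (restrictedForm h s) v x y =
      ∑ n : s, ∑ m : s, y n • x m • partialT m (h n) (inclTimes s v) := by
    intro x y
    rw [hd.fderiv]
    simp only [_root_.sum_apply, ContinuousLinearMap.comp_apply,
      ContinuousLinearMap.smulRightL_apply_apply, ContinuousLinearMap.smulRight_apply,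
      ContinuousLinearMap.proj_apply, fderiv_comp_inclTimes (hs _), Finset.smul_sum]
  rw [hxy, hxy, Finset.sum_comm]
  refine Finset.sum_congr rfl fun m _ => Finset.sum_congr rfl fun n _ => ?_
  rw [smul_comm, closed]

/-- The normalization u 0 = 0 makes the primitive unique, so that those for different finite sets of
times fit together. -/
theorem exists_primitive {h : ℕ+ → TimeSpace → 𝕜} (hs : ∀ n, IsSmooth (h n))
    (closed : ∀ m n, partialT m (h n) = partialT n (h m)) (s : Finset ℕ+) :
    ∃ u : (s → ℝ) → 𝕜, u 0 = 0 ∧ ∀ v, HasFDerivAt u (restrictedForm h s v) v := by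
  obtain ⟨u, hu⟩ := convex_univ.exists_forall_hasFDerivAt_of_fderiv_symmetric isOpen_univ
    ((contDiff_restrictedForm hs s).differentiable (by simp)).differentiableOn
    fun v _ => fderiv_restrictedForm_symm hs closed s v
  exact ⟨fun v => u v - u 0, sub_self _, fun v => (hu v trivial).sub_const _⟩

theorem exists_support_subset {E : Type*} [NormedAddCommGroup E] [NormedSpace ℝ E]
    [FiniteDimensional ℝ E] (A : E →ₗ[ℝ] TimeSpace) :
    ∃ s : Finset ℕ+, ∀ v, (A v).support ⊆ s := by
  classical
  let b := Module.finBasis ℝ E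
  refine ⟨Finset.univ.biUnion fun i => (A (b i)).support, fun v => ?_⟩
  rw [← Finset.coe_subset, ← Finsupp.mem_supported (R := ℝ) (M := ℝ), ← b.sum_repr v, map_sum]
  refine Submodule.sum_mem _ fun i _ => ?_
  rw [map_smul]
  refine Submodule.smul_mem _ _ ((Finsupp.mem_supported _ _).mpr ?_)
  exact Finset.coe_subset.mpr
    (Finset.subset_biUnion_of_mem (fun i => (A (b i)).support) (Finset.mem_univ i))

/-- The Poincaré lemma for smooth functions of the times. -/
theorem exists_smooth_primitive {h : ℕ+ → TimeSpace → 𝕜} (hs : ∀ n, IsSmooth (h n))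
    (closed : ∀ m n, partialT m (h n) = partialT n (h m)) :
    ∃ c : TimeSpace → 𝕜, IsSmooth c ∧ ∀ n, partialT n c = h n := by
  choose u hu0 hu using exists_primitive hs closed
  -- On the smaller space both functions have the same derivative and vanish at 0.
  have hcomp : ∀ (s s₀ : Finset ℕ+) (hss : s₀ ⊆ s) (v : s₀ → ℝ),
      u s (projTimes s (inclTimes s₀ v)) = u s₀ v := by
    intro s s₀ hss
    let j : (s₀ → ℝ) →L[ℝ] (s → ℝ) :=
      LinearMap.toContinuousLinearMap (projTimes s ∘ₗ inclTimes s₀)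
    have hj : ∀ v, inclTimes s (j v) = inclTimes s₀ v := fun v =>
      inclTimes_projTimes ((support_inclTimes_subset s₀ v).trans hss)
    have h1 : ∀ v, HasFDerivAt (fun v => u s (j v)) (restrictedForm h s₀ v) v := by
      intro v
      have := (hu s (j v)).comp v j.hasFDerivAt
      refine this.congr_fderiv (ContinuousLinearMap.ext fun w => ?_)
      rw [ContinuousLinearMap.comp_apply, restrictedForm_apply, restrictedForm_apply, hj, hj]
    have h2 : ∀ v, HasFDerivAt (fun v => u s (j v) - u s₀ v) (0 : (s₀ → ℝ) →L[ℝ] 𝕜) v := fun v =>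
      ((h1 v).sub (hu s₀ v)).congr_fderiv (sub_self _)
    intro v
    have h3 := is_const_of_fderiv_eq_zero (𝕜 := ℝ) (fun v => (h2 v).differentiableAt)
      (fun v => (h2 v).fderiv) v 0
    simp only [map_zero, hu0, sub_self] at h3
    exact sub_eq_zero.mp h3
  let c : TimeSpace → 𝕜 := fun t => u t.support (projTimes t.support t)
  have hc : ∀ (s : Finset ℕ+) (v : s → ℝ), c (inclTimes s v) = u s v := by
    intro s v
    have := hcomp s (inclTimes s v).support (support_inclTimes_subset s v)
      (projTimes _ (inclTimes s v))
    rw [inclTimes_projTimes subset_rfl, projTimes_inclTimes] at this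
    exact this.symm
  have hsmooth : IsSmooth c := by
    intro E _ _ _ A
    obtain ⟨s, hA⟩ := exists_support_subset A
    have hcA : (fun v => c (A v)) = fun v =>
        u s (LinearMap.toContinuousLinearMap (projTimes s ∘ₗ A) v) := by
      funext v
      rw [← hc]
      congr 1
      exact (inclTimes_projTimes (hA v)).symm
    have hus : ContDiff ℝ (⊤ : ℕ∞) (u s) := by
      refine contDiff_infty_iff_fderiv.mpr ⟨fun v => (hu s v).differentiableAt, ?_⟩
      rw [show fderiv ℝ (u s) = restrictedForm h s from funext fun v => (hu s v).fderiv]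
      exact contDiff_restrictedForm hs s
    rw [hcA]
    exact hus.comp (ContinuousLinearMap.contDiff _)
  refine ⟨c, hsmooth, fun n => funext fun t => ?_⟩
  -- The support of t is enlarged by n so that the direction t_n lies in the finite-dimensional
  -- space.
  have hn : n ∈ insert n t.support := Finset.mem_insert_self _ _
  have ht : inclTimes (insert n t.support) (projTimes _ t) = t :=
    inclTimes_projTimes (Finset.subset_insert _ _)
  have key := partialT_eq_fderiv hsmooth (inclTimes (insert n t.support))
    (Pi.single ⟨n, hn⟩ 1) n (inclTimes_single _ ⟨n, hn⟩) (projTimes _ t)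
  rw [ht] at key
  rw [key, funext (hc _), (hu _ _).fderiv, restrictedForm_apply, inclTimes_single, oneForm_single,
    ht]

theorem smoothTimes_poincare (𝕜 : Type*) [RCLike 𝕜] : (smoothTimes 𝕜).Poincare := by
  intro h hc
  obtain ⟨c, hs, hc'⟩ := exists_smooth_primitive (fun n => (h n).2) fun m n =>
    congrArg Subtype.val (hc m n)
  exact ⟨⟨c, hs⟩, fun n => Subtype.ext (hc' n)⟩

end Smooth

section Constants

variable {R : Type*} [Ring R] {T : Times R}

/-- The additive group of functions independent of the times. -/
def Fn.constants (T : Times R) : AddSubgroup (Fn R) where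
  carrier := {f | ∀ r, Fn.dt T r f = 0}
  zero_mem' r := Fn.dt_zero T r
  add_mem' hf hg r := by rw [Fn.dt_add, hf r, hg r, add_zero]
  neg_mem' hf r := by rw [Fn.dt_neg, hf r, neg_zero]

theorem PDO.tIndependent_iff {A : PDO T} :
    A.TIndependent ↔ ∀ j, A.coeff j ∈ Fn.constants T :=
  ⟨fun h j r => congrFun (congrArg PDO.coeff (h r)) j,
    fun h r => PDO.ext (funext fun j => h j r)⟩

end Constants

/-! ### Removing the defects by right multiplication -/

namespace Dressing

open PDO

variable {R : Type*} [Ring R] [Algebra ℚ R] {T : Times R} {φ : Dressing T}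

/-- A dressing operator of a solution of the hierarchy for `L` can be multiplied from the right by
an operator independent of `x`, to satisfy the hierarchy for `X`. -/
theorem exists_ncKPHierarchy (hT : T.Poincare) (h : φ.lax.NcKPHierarchy) :
    ∃ (C : PDO T) (χ : Dressing T), C.IsMonic ∧ C.XIndependent ∧ χ.X = φ.X * C ∧
      χ.NcKPHierarchy := by
  have hx := φ.ncKPHierarchy_lax_iff.mp h
  obtain ⟨C, hC, -, hCt⟩ := exists_horizontal
    (fun n : ℕ+ => AddMonoidHom.mk' (Fn.dt T n) (Fn.dt_add n)) (fun n => dt n)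
    (fun _ _ _ => rfl) (fun n => Fn.dt_one n) ⊤ trivial
    (fun h _ hc => by
      obtain ⟨c, hc'⟩ := hT.fn h hc
      exact ⟨c, trivial, hc'⟩)
    φ.timeDefect φ.timeDefect_orderLE (fun _ _ _ _ => trivial)
    fun m n C _ => by
      have e : (φ.timeDefect n).dt m * C + φ.timeDefect m * (φ.timeDefect n * C) =
          (φ.timeDefect m).dt n * C + φ.timeDefect n * (φ.timeDefect m * C) := by
        rw [← mul_assoc, ← mul_assoc, ← add_mul, φ.timeDefect_flat hx, add_mul]
      rw [dt_add, dt_add, dt_mul, dt_mul, dt_comm n m, mul_add, mul_add]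
      rw [← sub_eq_zero] at e ⊢
      rw [← e]
      abel
  obtain ⟨χ, hχ⟩ := φ.exists_mul hC
  -- The n = 1 equation holds for every X: L = ∂ - X_x X⁻¹, so Q_1 = -X_x X⁻¹. Hence C_x = -F_1 C =
  -- 0.
  have h1 : φ.timeDefect 1 = 0 := by
    have hL : φ.lax = del T 1 + -(φ.X.dt 1 * φ.inv) := by
      refine φ.mul_X_cancel ?_
      rw [add_mul, del_one_mul, neg_mul, mul_assoc _ φ.inv, φ.inv_mul, mul_one, lax_mul]
      abel
    have hQ : φ.Q 1 = -(φ.X.dt 1 * φ.inv) := by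
      rw [Q, PNat.one_coe, pow_one]
      exact negPart_eq hL (del_isDifferential 1)
        (((φ.monic.dt_orderLE 1).mul φ.inv_isMonic.orderLE).mono (by omega)).neg
    rw [timeDefect_eq_zero_iff, hQ, neg_mul, neg_neg, mul_assoc, φ.inv_mul, mul_one]
  have hCx : C.XIndependent := by
    rw [XIndependent, hCt, h1, zero_mul, neg_zero]
  refine ⟨C, χ, hC, hCx, hχ, χ.ncKPHierarchy_iff.mpr fun n => ?_⟩
  have hQ : χ.Q n = φ.Q n := by rw [Q, Q, lax_eq_of_commute hCx hχ]
  rw [timeDefect_eq_zero_iff, hQ, hχ, dt_mul, hCt, X_dt]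
  noncomm_ring

/-- Multiplying a dressing operator which satisfies the hierarchy by an operator independent of
the times. -/
theorem NcKPHierarchy.mul {χ : Dressing T} {C : PDO T} (h : φ.NcKPHierarchy)
    (hC : C.TIndependent) (hχ : χ.X = φ.X * C) : χ.NcKPHierarchy := by
  refine χ.ncKPHierarchy_iff.mpr fun n => ?_
  have hQ : χ.Q n = φ.Q n := by rw [Q, Q, lax_eq_of_commute hC.xIndependent hχ]
  rw [timeDefect_eq_zero_iff, hQ, hχ, dt_mul, hC, mul_zero, add_zero,
    timeDefect_eq_zero_iff.mp (φ.ncKPHierarchy_iff.mp h n), neg_mul, mul_assoc]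

theorem TIndependent.mul {A B : PDO T} (hA : A.TIndependent) (hB : B.TIndependent) :
    (A * B).TIndependent := fun r => by
  rw [dt_mul, hA r, hB r, zero_mul, mul_zero, add_zero]

/-- The system C_θ = -G C is flat by `defect_flat`, and G is independent of the times, so it is
solved within the time-independent operators. Such a C preserves (2), leaves L and Z unchanged and
cancels the term X G. -/
theorem exists_deformationEqLax (h : φ.NcKPHierarchy) (S : Set (ℕ+ × ℕ+))
    (hS : ∀ p ∈ S, φ.lax.DeformationEq p.1 p.2) :
    ∃ (C : PDO T) (χ : Dressing T), C.IsMonic ∧ C.TIndependent ∧ χ.X = φ.X * C ∧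
      χ.NcKPHierarchy ∧ ∀ p ∈ S, χ.DeformationEqLax p.1 p.2 := by
  -- Only the θ_{m,n} with m < n are independent; pairs of S in the opposite order differ by a sign,
  -- and diagonal pairs impose nothing.
  let S' : Set Theta := {q | q.1 ∈ S ∨ q.1.swap ∈ S}
  have hF : ∀ q : S', (φ.defect q.1.1.1 q.1.1.2).TIndependent := by
    rintro ⟨q, hq | hq⟩
    · exact defect_tIndependent h ((lax_deformationEq_iff h _ _).mp (hS _ hq))
    · have := (lax_deformationEq_iff h _ _).mp (hS _ hq)
      refine defect_tIndependent h ?_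
      rw [defect_swap, xIndependent_iff_commute]
      exact ((xIndependent_iff_commute _).mp this).neg_right
  have hd : ∀ (q : Theta) (f : Fn R), Fn.dtheta q.1.1 q.1.2 f = Fn.pd q f := fun q f =>
    Fn.dtheta_of_lt q.2 f
  obtain ⟨C, hC, hCQ, hCt⟩ := exists_horizontal (T := T)
    (fun q : S' => AddMonoidHom.mk' (Fn.pd q.1) (Fn.pd_add q.1))
    (fun q => dtheta q.1.1.1 q.1.1.2) (fun q A j => hd q.1 _) (fun q => Fn.pd_one q.1)
    (Fn.constants T) (fun r => Fn.dt_one r)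
    (fun h hQ hc => by
      obtain ⟨c, hc', hcc⟩ := Fn.exists_pd_eq S' h hc
      refine ⟨c, fun r => funext fun γ => ?_, hc'⟩
      change T.D r (c γ) = 0
      rcases hcc γ with h0 | ⟨a, p, δ, h0⟩
      · rw [h0, map_zero]
      · rw [h0, map_rat_smul (T.D r)]
        have : T.D r (h p δ) = 0 := congrFun (hQ p r) δ
        rw [this, smul_zero])
    (fun q => φ.defect q.1.1.1 q.1.1.2) (fun q => φ.defect_orderLE _ _)
    (fun q C hC j => by
      have hC' := tIndependent_iff.mpr hC
      refine tIndependent_iff.mp (fun r => ?_) j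
      rw [dt_add, dt_dtheta, hC' r, TIndependent.mul (hF q) hC' r, add_zero]
      exact PDO.ext (funext fun _ => Fn.dtheta_zero _ _))
    (fun p q C hC => by
      have e : (φ.defect q.1.1.1 q.1.1.2).dtheta p.1.1.1 p.1.1.2 * C +
          φ.defect p.1.1.1 p.1.1.2 * (φ.defect q.1.1.1 q.1.1.2 * C) =
          (φ.defect p.1.1.1 p.1.1.2).dtheta q.1.1.1 q.1.1.2 * C +
          φ.defect q.1.1.1 q.1.1.2 * (φ.defect p.1.1.1 p.1.1.2 * C) := by
        rw [← mul_assoc, ← mul_assoc, ← add_mul, defect_flat h (hF p) (hF q), add_mul]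
      rw [dtheta_add, dtheta_add, (hF q).dtheta_mul, (hF p).dtheta_mul,
        dtheta_comm q.1.1.1 q.1.1.2, mul_add, mul_add]
      rw [← sub_eq_zero] at e ⊢
      rw [← e]
      abel)
  have hCT := tIndependent_iff.mpr hCQ
  obtain ⟨χ, hχ⟩ := φ.exists_mul hC
  refine ⟨C, χ, hC, hCT, hχ, h.mul hCT hχ, ?_⟩
  have hZ : ∀ m n, χ.Z m n = φ.Z m n := fun m n => by
    simp only [Z, Q, lax_eq_of_commute hCT.xIndependent hχ]
  have key : ∀ q : S', χ.defect q.1.1.1 q.1.1.2 = 0 := by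
    intro q
    rw [defect, hZ, hχ, dtheta_mul_of_tIndependent _ hCT, hCt, X_dtheta,
      show ∀ A F : PDO T, (A * φ.X + φ.X * F) * C + φ.X * -(F * C) - A * (φ.X * C) = 0 by
        intro A F; noncomm_ring, mul_zero]
  rintro ⟨m, n⟩ hp
  rw [deformationEqLax_iff]
  rcases lt_trichotomy m n with hlt | rfl | hlt
  · exact key ⟨⟨(m, n), hlt⟩, Or.inl hp⟩
  · exact χ.defect_self m
  · rw [defect_swap, neg_eq_zero]
    exact key ⟨⟨(n, m), hlt⟩, Or.inr hp⟩

theorem lax_deformationEq (h : φ.NcKPHierarchy) {m n : ℕ+} (h' : φ.DeformationEqLax m n) :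
    φ.lax.DeformationEq m n := by
  rw [lax_deformationEq_iff h, deformationEqLax_iff.mp h']
  exact ((tIndependent_iff (A := (0 : PDO T))).mpr fun _ => zero_mem _).xIndependent

theorem lax_deformationEq_of_mul {χ : Dressing T} {C : PDO T} (hC : C.XIndependent)
    (hχ : χ.X = φ.X * C) (h : χ.NcKPHierarchy) {m n : ℕ+} (h' : χ.DeformationEqLax m n) :
    φ.lax.DeformationEq m n := by
  rw [← lax_eq_of_commute hC hχ]
  exact lax_deformationEq h h'

/-- Two successive corrections: an x-independent factor achieves (2) without changing L, then a
time-independent one achieves (5). Their product is only x-independent. -/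
theorem deformationEq_lax_iff_exists (hT : T.Poincare) (h : φ.lax.NcKPHierarchy)
    (S : Set (ℕ+ × ℕ+)) :
    (∀ p ∈ S, φ.lax.DeformationEq p.1 p.2) ↔
      ∃ (C : PDO T) (χ : Dressing T), C.IsMonic ∧ C.XIndependent ∧
        χ.X = φ.X * C ∧ χ.NcKPHierarchy ∧ ∀ p ∈ S, χ.DeformationEqLax p.1 p.2 := by
  constructor
  · intro hS
    obtain ⟨C, χ, hC, hCx, hχ, hχK⟩ := exists_ncKPHierarchy hT h
    obtain ⟨C', χ', hC', hCt', hχ', hχK', hS'⟩ := exists_deformationEqLax hχK S fun p hp => by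
      rw [lax_eq_of_commute hCx hχ]
      exact hS p hp
    exact ⟨C * C', χ', hC.mul hC', hCx.mul hCt'.xIndependent, by rw [hχ', hχ, mul_assoc], hχK',
      hS'⟩
  · rintro ⟨C, χ, -, hCx, hχ, hχK, hS⟩ p hp
    exact lax_deformationEq_of_mul hCx hχ hχK (hS p hp)

theorem exists_deformationEq_iff_lax (I : PDO T → Prop) (S : Set (ℕ+ × ℕ+)) :
    (∃ (C : PDO T) (χ : Dressing T), C.IsMonic ∧ I C ∧
        χ.X = φ.X * C ∧ χ.NcKPHierarchy ∧ ∀ p ∈ S, χ.DeformationEq p.1 p.2) ↔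
      ∃ (C : PDO T) (χ : Dressing T), C.IsMonic ∧ I C ∧
        χ.X = φ.X * C ∧ χ.NcKPHierarchy ∧ ∀ p ∈ S, χ.DeformationEqLax p.1 p.2 := by
  refine exists_congr fun C => exists_congr fun χ => and_congr_right fun _ =>
    and_congr_right fun _ => and_congr_right fun _ => and_congr_right fun h => ?_
  simp only [deformationEq_iff_lax h]

end Dressing

end

end NcKP

theorem theorem3p1 :
    -- Any ring of functions of the times; `X` satisfies the ncKP equations.
    (∀ (R : Type*) [Ring R] [Algebra ℚ R] (T : NcKP.Times R) (φ : NcKP.Dressing T),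
      φ.NcKPHierarchy →
        (∀ m n : ℕ+, φ.DeformationEq m n ↔ φ.DeformationEqLax m n) ∧
        (∀ m n : ℕ+, φ.DeformationEq m n → φ.lax.DeformationEq m n) ∧
        ∀ S : Set (ℕ+ × ℕ+),
          ((∀ p ∈ S, φ.lax.DeformationEq p.1 p.2) ↔
            ∃ (C : NcKP.PDO T) (χ : NcKP.Dressing T), C.IsMonic ∧ C.TIndependent ∧
              χ.X = φ.X * C ∧ χ.NcKPHierarchy ∧ ∀ p ∈ S, χ.DeformationEq p.1 p.2) ∧
          ((∀ p ∈ S, φ.lax.DeformationEq p.1 p.2) ↔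
            ∃ (C : NcKP.PDO T) (χ : NcKP.Dressing T), C.IsMonic ∧ C.TIndependent ∧
              χ.X = φ.X * C ∧ χ.NcKPHierarchy ∧ ∀ p ∈ S, χ.DeformationEqLax p.1 p.2)) ∧
    -- Matrices of formal power series in the times; only `L` satisfies the ncKP equations.
    (∀ (K : Type*) [CommRing K] [Algebra ℚ K] (N : ℕ)
      (φ : NcKP.Dressing ((NcKP.formalTimes K).matrix N)), φ.lax.NcKPHierarchy →
        ∀ S : Set (ℕ+ × ℕ+),
          ((∀ p ∈ S, φ.lax.DeformationEq p.1 p.2) ↔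
            ∃ (C : NcKP.PDO ((NcKP.formalTimes K).matrix N))
              (χ : NcKP.Dressing ((NcKP.formalTimes K).matrix N)),
              C.IsMonic ∧ C.XIndependent ∧
              χ.X = φ.X * C ∧ χ.NcKPHierarchy ∧ ∀ p ∈ S, χ.DeformationEq p.1 p.2) ∧
          ((∀ p ∈ S, φ.lax.DeformationEq p.1 p.2) ↔
            ∃ (C : NcKP.PDO ((NcKP.formalTimes K).matrix N))
              (χ : NcKP.Dressing ((NcKP.formalTimes K).matrix N)),
              C.IsMonic ∧ C.XIndependent ∧
              χ.X = φ.X * C ∧ χ.NcKPHierarchy ∧ ∀ p ∈ S, χ.DeformationEqLax p.1 p.2)) ∧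
    -- Matrices of smooth functions of the times; only `L` satisfies the ncKP equations.
    (∀ (𝕜 : Type*) [RCLike 𝕜] (N : ℕ)
      (φ : NcKP.Dressing ((NcKP.smoothTimes 𝕜).matrix N)), φ.lax.NcKPHierarchy →
        ∀ S : Set (ℕ+ × ℕ+),
          ((∀ p ∈ S, φ.lax.DeformationEq p.1 p.2) ↔
            ∃ (C : NcKP.PDO ((NcKP.smoothTimes 𝕜).matrix N))
              (χ : NcKP.Dressing ((NcKP.smoothTimes 𝕜).matrix N)),
              C.IsMonic ∧ C.XIndependent ∧
              χ.X = φ.X * C ∧ χ.NcKPHierarchy ∧ ∀ p ∈ S, χ.DeformationEq p.1 p.2) ∧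
          ((∀ p ∈ S, φ.lax.DeformationEq p.1 p.2) ↔
            ∃ (C : NcKP.PDO ((NcKP.smoothTimes 𝕜).matrix N))
              (χ : NcKP.Dressing ((NcKP.smoothTimes 𝕜).matrix N)),
              C.IsMonic ∧ C.XIndependent ∧
              χ.X = φ.X * C ∧ χ.NcKPHierarchy ∧ ∀ p ∈ S, χ.DeformationEqLax p.1 p.2)) := by
  refine ⟨fun R _ _ T φ h => ⟨NcKP.Dressing.deformationEq_iff_lax h, fun m n h' =>
    NcKP.Dressing.lax_deformationEq h ((NcKP.Dressing.deformationEq_iff_lax h m n).mp h'),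
    fun S => ?_⟩, fun K _ _ N φ h S => ?_, fun 𝕜 _ N φ h S => ?_⟩
  -- The existential statement includes (2) for the new operator, so (4) may be exchanged for (5)
  -- and both equivalences become one.
  · rw [NcKP.Dressing.exists_deformationEq_iff_lax, and_self]
    refine ⟨NcKP.Dressing.exists_deformationEqLax h S, ?_⟩
    rintro ⟨C, χ, -, hC, hχ, hK, hS⟩ p hp
    exact NcKP.Dressing.lax_deformationEq_of_mul hC.xIndependent hχ hK (hS p hp)
  · rw [NcKP.Dressing.exists_deformationEq_iff_lax, and_self]
    exact NcKP.Dressing.deformationEq_lax_iff_exists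
      ((NcKP.formalTimes_poincare K).matrix N) h S
  · rw [NcKP.Dressing.exists_deformationEq_iff_lax, and_self]
    exact NcKP.Dressing.deformationEq_lax_iff_exists
      ((NcKP.smoothTimes_poincare 𝕜).matrix N) h S
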